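/- Let $p\ge 1$ be an integer, $\beta>0$ a real number, and $Q$ a real symmetric positive definite $p\times p$ matrix. For $\varepsilon>0$ and $\theta=(\theta_i)_{i\ge1}$ with $\theta_i\in\mathbb{R}^p$, let $y=(y_i)_{i\ge 1}$ be observed from the multivariate Gaussian sequence model $y_i=\theta_i+\varepsilon\xi_i$, $i=1,2,\dots$, where the $\xi_i\sim \mathrm{N}_p(0,I_p)$ are independent. Let $$a_{\beta,i}=\begin{cases} i^\beta, & i \text{ even},\\ (i-1)^\beta, & i\text{ odd},\end{cases}\qquad \Theta(\beta,Q)=\Big\{\theta=(\theta_1,\theta_2,\dots)\ \Big|\ \sum_{i=1}^\infty a_{\beta,i}^2\,\theta_i^\top Q^{-1}\theta_i\le 1\Big\}.$$ An estimator is a measurable function $\hat\theta=\hat\theta(y)$ with values in $(\mathbb{R}^p)^{\mathbb N}$; its risk is $$R_Q(\theta,\hat\theta)=\mathrm{E}_\theta\Big[\sum_{i=1}^\infty(\hat\theta_i-\theta_i)^\top Q(\hat\theta_i-\theta_i)\Big]\in[0,\infty].$$ For a symmetric matrix $S$ with spectral decomposition $S=U^\top\mathrm{diag}(\lambda_1,\dots,\lambda_p)U$,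 put $S_+=U^\top\mathrm{diag}(\max(0,\lambda_1),\dots,\max(0,\lambda_p))U$. Then for every $\varepsilon>0$ the equation $$\varepsilon^2\kappa^{-1}\sum_{i=1}^\infty a_{\beta,i}\,\mathrm{tr}\,(I_p-a_{\beta,i}\kappa Q^{-1})_+=1$$ has a unique solution $\kappa=\kappa_\varepsilon>0$. Let $\hat\theta_{\mathrm P}$ be the linear estimator $\hat\theta_{\mathrm P,i}=C_{\mathrm P,i}\,y_i$ with $C_{\mathrm P,i}=(I_p-a_{\beta,i}\kappa_\varepsilon Q^{-1})_+$. Then $\hat\theta_{\mathrm P}$ is asymptotically minimax on $\Theta(\beta,Q)$: as $\varepsilon\to0$, $$\sup_{\theta\in\Theta(\beta,Q)}R_Q(\theta,\hat\theta_{\mathrm P})\ \sim\ \inf_{\hat\theta}\ \sup_{\theta\in\Theta(\beta,Q)}R_Q(\theta,\hat\theta)\ \sim\ P(\beta,Q)\,\varepsilon^{4\beta/(2\beta+1)},$$ where the infimum is over all estimators (which may depend on $\varepsilon$, $\beta$ and $Q$), $u\sim v$ means $u/v\to1$, and $$P(\beta,Q)=(2\beta+1)^{1/(2\beta+1)}\left(\frac{\beta\,\mathrm{tr}(Q^{(\beta+1)/\beta})}{\beta+1}\right)^{2\beta/(2\beta+1)}.$$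 -/

import Mathlib

open MeasureTheory ProbabilityTheory Filter Topology
open scoped ENNReal Matrix

noncomputable section

namespace MPinsker

/-- Sequences `(x₁, x₂, …)` of vectors in `ℝᵖ`. The vector `x_{i+1}` of the usual numbering from `1`
is stored at index `i : ℕ`. -/
abbrev Seq (p : ℕ) : Type := ℕ → Fin p → ℝ

/-- The Sobolev coefficient `a_{β,k}`, numbered from `k = 1`: `k ^ β` for even `k` and
`(k - 1) ^ β` for odd `k`. It is only used at `k = i + 1`. -/
def sobolevCoeff (β : ℝ) (k : ℕ) : ℝ :=
  if Even k then (k : ℝ) ^ β else ((k : ℝ) - 1) ^ β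

/-- The quadratic form `xᵀ A x`. -/
def quadForm {p : ℕ} (A : Matrix (Fin p) (Fin p) ℝ) (x : Fin p → ℝ) : ℝ :=
  x ⬝ᵥ (A *ᵥ x)

/-- The multivariate Sobolev ellipsoid: `∑ₖ a_{β,k}² θₖᵀ Q⁻¹ θₖ ≤ 1`. -/
def sobolevEllipsoid {p : ℕ} (β : ℝ) (Q : Matrix (Fin p) (Fin p) ℝ) : Set (Seq p) :=
  {θ | ∑' i : ℕ, ENNReal.ofReal (sobolevCoeff β (i + 1) ^ 2 * quadForm Q⁻¹ (θ i)) ≤ 1}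

/-- Law of the noise `(ξ₁, ξ₂, …)`: the `ξᵢ` are independent with law `N_p(0, I_p)`. -/
def noiseLaw (p : ℕ) : Measure (Seq p) :=
  Measure.infinitePi fun _ : ℕ => Measure.pi fun _ : Fin p => gaussianReal 0 1

/-- Law of the observation `yᵢ = θᵢ + ε ξᵢ`, `i = 1, 2, …`. -/
def observationLaw {p : ℕ} (ε : ℝ) (θ : Seq p) : Measure (Seq p) :=
  (noiseLaw p).map fun ξ i => θ i + ε • ξ i

/-- An estimator is a measurable function of the observation `y`. -/
def Estimator (p : ℕ) : Type := {f : Seq p → Seq p // Measurable f}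

/-- The quadratic loss `L_Q(θ, t) = ∑ᵢ (tᵢ - θᵢ)ᵀ Q (tᵢ - θᵢ)`, possibly infinite. -/
def loss {p : ℕ} (Q : Matrix (Fin p) (Fin p) ℝ) (θ t : Seq p) : ℝ≥0∞ :=
  ∑' i : ℕ, ENNReal.ofReal (quadForm Q (t i - θ i))

/-- The risk `R_Q(θ, f) = E_θ [L_Q(θ, f(y))]` at noise level `ε`. -/
def risk {p : ℕ} (Q : Matrix (Fin p) (Fin p) ℝ) (ε : ℝ) (θ : Seq p) (f : Estimator p) : ℝ≥0∞ :=
  ∫⁻ y, loss Q θ (f.1 y) ∂(observationLaw ε θ)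

/-- The maximal risk of an estimator over a parameter space. -/
def maxRisk {p : ℕ} (Q : Matrix (Fin p) (Fin p) ℝ) (ε : ℝ) (Θ : Set (Seq p)) (f : Estimator p) :
    ℝ≥0∞ :=
  ⨆ θ ∈ Θ, risk Q ε θ f

/-- The minimax risk over a parameter space. -/
def minimaxRisk {p : ℕ} (Q : Matrix (Fin p) (Fin p) ℝ) (ε : ℝ) (Θ : Set (Seq p)) : ℝ≥0∞ :=
  ⨅ f : Estimator p, maxRisk Q ε Θ f

/-- The positive part `S₊` of a symmetric matrix: every eigenvalue `λ` is replaced by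
`max 0 λ` in a spectral decomposition. -/
def matPosPart {p : ℕ} (S : Matrix (Fin p) (Fin p) ℝ) : Matrix (Fin p) (Fin p) ℝ :=
  cfc (fun x : ℝ => max 0 x) S

/-- The real power `A ^ r` of a positive definite matrix: every eigenvalue `λ` is replaced by
`λ ^ r` in a spectral decomposition. -/
def matRpow {p : ℕ} (A : Matrix (Fin p) (Fin p) ℝ) (r : ℝ) : Matrix (Fin p) (Fin p) ℝ :=
  cfc (fun x : ℝ => x ^ r) A

/-- The coefficient matrix `(I_p - a_{β,k} κ Q⁻¹)₊` with `k = i + 1`. -/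
def pinskerCoeff {p : ℕ} (β : ℝ) (Q : Matrix (Fin p) (Fin p) ℝ) (κ : ℝ) (i : ℕ) :
    Matrix (Fin p) (Fin p) ℝ :=
  matPosPart (1 - (sobolevCoeff β (i + 1) * κ) • Q⁻¹)

/-- `κ` is a positive solution of `ε² κ⁻¹ ∑ₖ a_{β,k} tr (I_p - a_{β,k} κ Q⁻¹)₊ = 1`. -/
def IsPinskerRoot {p : ℕ} (β : ℝ) (Q : Matrix (Fin p) (Fin p) ℝ) (ε κ : ℝ) : Prop :=
  0 < κ ∧
    ε ^ 2 * κ⁻¹ * ∑' i : ℕ, sobolevCoeff β (i + 1) * (pinskerCoeff β Q κ i).trace = 1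

/-- The linear estimator `yᵢ ↦ Cᵢ yᵢ`. -/
def linearEstimator {p : ℕ} (C : ℕ → Matrix (Fin p) (Fin p) ℝ) : Estimator p :=
  ⟨fun y i => C i *ᵥ y i, by
    refine measurable_pi_iff.2 fun i => measurable_pi_iff.2 fun j => ?_
    simp only [Matrix.mulVec, dotProduct]
    fun_prop⟩

/-- The Pinsker constant `P(β, Q)`. -/
def pinskerConst {p : ℕ} (β : ℝ) (Q : Matrix (Fin p) (Fin p) ℝ) : ℝ :=
  (2 * β + 1) ^ (1 / (2 * β + 1)) *
    (β * (matRpow Q ((β + 1) / β)).trace / (β + 1)) ^ (2 * β / (2 * β + 1))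

/-- `u ~ v` as `ε → 0` through positive values: the ratio tends to `1`. -/
def AsympEquiv (u v : ℝ → ℝ≥0∞) : Prop :=
  Tendsto (fun ε => u ε / v ε) (𝓝[>] 0) (𝓝 1)

end MPinsker

end

/-!
Let `Q = U diag(q) Uᵀ`. In the coordinates `√qⱼ (Uᵀ θᵢ)ⱼ`, `k = (i, j)`, the model becomes a scalar
sequence model `yₖ = θₖ + σₖ ξₖ` with `ℓ²` loss over the ellipsoid `∑ₖ aₖ² θₖ² ≤ 1`, where
`aₖ = a_{β,i} / qⱼ` and `σₖ = ε √qⱼ`, and the Pinsker filter multiplies `yₖ` by `wₖ = (1 - κ aₖ)₊`.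
The equation for `κ` reads `∑ₖ σₖ² aₖ wₖ = κ`, and the value of the problem is `Λ = ∑ₖ σₖ² wₖ`.

Upper bound: `(1 - wₖ)² ≤ κ² aₖ²`, so the squared bias is at most `κ²` on the ellipsoid, and
`κ² + ∑ₖ σₖ² wₖ² = Λ` by the equation for `κ`.

Lower bound: under independent Gaussian priors with variances `τₖ² = σₖ² wₖ / (κ aₖ)`, the Bayes
risk `∑ₖ σₖ² τₖ² / (σₖ² + τₖ²)` is `Λ`, and the mean of `∑ₖ aₖ² θₖ²` is `1` by the equation for `κ`.
Once the variances are multiplied by `1 - δ` and the indices with `i < δ κ^{-1/β}`, where `aₖ` is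
small or zero, are dropped, the variance of this sum tends to `0`, so by Chebyshev's inequality the
prior concentrates on the ellipsoid.

Rate: as `κ → 0`, the Riemann sums `κ^{1/β} ∑ₖ qⱼ φ(κ aₖ)` tend to
`tr(Q^{(β+1)/β}) ∫₀¹ φ(x^β) dx`.
-/

noncomputable section

namespace MPinsker

section AsympEquiv

variable {u v w : ℝ → ℝ≥0∞}

lemma AsympEquiv.eventually_ne_zero_ne_top (h : AsympEquiv u v) :
    ∀ᶠ ε in 𝓝[>] 0, (u ε ≠ 0 ∧ u ε ≠ ∞) ∧ v ε ≠ 0 ∧ v ε ≠ ∞ := by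
  filter_upwards [Tendsto.eventually_ne h one_ne_zero,
    Tendsto.eventually_ne h ENNReal.one_ne_top] with ε h0 htop
  rw [Ne, ENNReal.div_eq_zero_iff, not_or] at h0
  rw [Ne, ENNReal.div_eq_top, not_or, not_and, not_and] at htop
  exact ⟨⟨h0.1, fun hu => htop.2 hu h0.2⟩, htop.1 h0.1, h0.2⟩

lemma AsympEquiv.symm (h : AsympEquiv u v) : AsympEquiv v u := by
  have hinv := tendsto_inv_iff.2 h
  rw [inv_one] at hinv
  refine hinv.congr' ?_
  filter_upwards [h.eventually_ne_zero_ne_top] with ε hε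
  exact ENNReal.inv_div (Or.inl hε.2.2) (Or.inl hε.2.1)

lemma AsympEquiv.trans (huv : AsympEquiv u v) (hvw : AsympEquiv v w) : AsympEquiv u w := by
  have hmul := ENNReal.Tendsto.mul huv (Or.inl one_ne_zero) hvw (Or.inl one_ne_zero)
  rw [one_mul] at hmul
  refine hmul.congr' ?_
  filter_upwards [huv.eventually_ne_zero_ne_top] with ε hε
  rw [← mul_div_assoc, ENNReal.div_mul_cancel hε.2.1 hε.2.2]

lemma asympEquiv_ofReal {f g : ℝ → ℝ} (hg : ∀ᶠ ε in 𝓝[>] 0, 0 < g ε)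
    (h : Tendsto (fun ε => f ε / g ε) (𝓝[>] 0) (𝓝 1)) :
    AsympEquiv (fun ε => ENNReal.ofReal (f ε)) (fun ε => ENNReal.ofReal (g ε)) := by
  have hlim := ENNReal.tendsto_ofReal h
  rw [ENNReal.ofReal_one] at hlim
  refine hlim.congr' ?_
  filter_upwards [hg] with ε hε
  exact ENNReal.ofReal_div_of_pos hε

lemma asympEquiv_ofReal_of_forall_mul_le {f : ℝ → ℝ} (hf : ∀ᶠ ε in 𝓝[>] 0, 0 < f ε)
    (hle : ∀ᶠ ε in 𝓝[>] 0, u ε ≤ ENNReal.ofReal (f ε))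
    (hge : ∀ c < 1, ∀ᶠ ε in 𝓝[>] 0, ENNReal.ofReal (c * f ε) ≤ u ε) :
    AsympEquiv u (fun ε => ENNReal.ofReal (f ε)) := by
  refine tendsto_order.2 ⟨fun a ha => ?_, fun a ha => ?_⟩
  · obtain ⟨c, -, hac, hc⟩ := ENNReal.lt_iff_exists_real_btwn.1 ha
    filter_upwards [hf, hge c (ENNReal.ofReal_lt_one.1 hc)] with ε hε hcε
    calc a < ENNReal.ofReal c := hac
      _ = ENNReal.ofReal (c * f ε) / ENNReal.ofReal (f ε) := by
        rw [← ENNReal.ofReal_div_of_pos hε, mul_div_cancel_right₀ c hε.ne']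
      _ ≤ u ε / ENNReal.ofReal (f ε) := ENNReal.div_le_div_right hcε _
  · filter_upwards [hle] with ε hε
    exact (ENNReal.div_le_of_le_mul (by rwa [one_mul])).trans_lt ha

end AsympEquiv

section RiemannSum

variable {E : Type*} [NormedAddCommGroup E] [NormedSpace ℝ E] [CompleteSpace E]

lemma norm_smul_sub_intervalIntegral_le {φ : ℝ → E} {a b η : ℝ} {e : E} (hab : a ≤ b)
    (hφ : IntervalIntegrable φ volume a b) (he : ∀ x ∈ Set.Ioc a b, ‖e - φ x‖ ≤ η) :
    ‖(b - a) • e - ∫ x in a..b, φ x‖ ≤ η * (b - a) := by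
  rw [← intervalIntegral.integral_const, ← intervalIntegral.integral_sub intervalIntegrable_const
    hφ, ← abs_of_nonneg (sub_nonneg.2 hab)]
  refine intervalIntegral.norm_integral_le_of_norm_le_const fun x hx => he x ?_
  rwa [← Set.uIoc_of_le hab]

lemma norm_sum_smul_sub_intervalIntegral_le {φ : ℝ → E} {t : ℕ → ℝ} {e : ℕ → E} {η : ℝ} {N : ℕ}
    (ht : Monotone t) (hφ : ∀ i < N, IntervalIntegrable φ volume (t i) (t (i + 1)))
    (he : ∀ i < N, ∀ x ∈ Set.Ioc (t i) (t (i + 1)), ‖e i - φ x‖ ≤ η) :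
    ‖∑ i ∈ Finset.range N, (t (i + 1) - t i) • e i - ∫ x in t 0..t N, φ x‖
      ≤ η * (t N - t 0) := by
  rw [← intervalIntegral.sum_integral_adjacent_intervals hφ, ← Finset.sum_sub_distrib,
    ← Finset.sum_range_sub, Finset.mul_sum]
  refine norm_sum_le_of_le _ fun i hi => ?_
  have hiN := Finset.mem_range.1 hi
  exact norm_smul_sub_intervalIntegral_le (ht i.le_succ) (hφ i hiN) (he i hiN)

lemma abs_mul_tsum_sub_integral_le {φ : ℝ → ℝ} (hφ : Continuous φ) (h0 : ∀ x, 1 ≤ x → φ x = 0)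
    {m : ℕ → ℝ} (hm : ∀ i : ℕ, (i : ℝ) ≤ m i) (hm' : ∀ i : ℕ, m i ≤ i + 1) {h η : ℝ} {N : ℕ}
    (hpos : 0 < h) (hN : 1 ≤ N * h)
    (hη : ∀ x ∈ Set.Icc 0 (N * h), ∀ y ∈ Set.Icc 0 (N * h), |x - y| ≤ h → |φ x - φ y| ≤ η) :
    |h * ∑' i, φ (h * m i) - ∫ x in (0 : ℝ)..1, φ x| ≤ η * (N * h) := by
  have hsum : h * ∑' i, φ (h * m i)
      = ∑ i ∈ Finset.range N, (((i + 1 : ℕ) : ℝ) * h - i * h) • φ (h * m i) := by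
    rw [tsum_eq_sum fun i hi => h0 _ ?_, Finset.mul_sum]
    · refine Finset.sum_congr rfl fun i _ => ?_
      push_cast
      rw [smul_eq_mul]
      ring
    · have : (N : ℝ) ≤ i := by exact_mod_cast not_lt.1 (mt Finset.mem_range.2 hi)
      nlinarith [hm i]
  have hint : ∫ x in (0 : ℝ)..1, φ x = ∫ x in ((0 : ℕ) : ℝ) * h..N * h, φ x := by
    rw [← intervalIntegral.integral_add_adjacent_intervals (b := 1) (c := N * h)
      (hφ.intervalIntegrable _ _) (hφ.intervalIntegrable _ _), Nat.cast_zero, zero_mul,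
      intervalIntegral.integral_zero_ae (a := 1), add_zero]
    refine Eventually.of_forall fun x hx => h0 x ?_
    rw [Set.uIoc_of_le hN] at hx
    exact hx.1.le
  rw [hsum, hint, ← Real.norm_eq_abs]
  refine (norm_sum_smul_sub_intervalIntegral_le (t := fun i : ℕ => (i : ℝ) * h) (η := η)
    (fun i j hij => by dsimp only; gcongr) (fun i _ => hφ.intervalIntegrable _ _)
    fun i hi x hx => ?_).trans_eq (by simp)
  have hiN : ((i : ℝ) + 1) * h ≤ N * h := by gcongr; exact_mod_cast hi
  have hi0 : 0 ≤ (i : ℝ) * h := by positivity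
  have hlow : (i : ℝ) * h ≤ h * m i := by nlinarith [hm i]
  have hupp : h * m i ≤ (i + 1) * h := by nlinarith [hm' i]
  push_cast at hx
  refine hη _ ⟨by linarith, by linarith⟩ _ ⟨by linarith [hx.1], by linarith [hx.2]⟩ ?_
  rw [abs_le]
  constructor <;> nlinarith [hx.1, hx.2]

theorem tendsto_mul_tsum_tagged {φ : ℝ → ℝ} (hφ : Continuous φ) (h0 : ∀ x, 1 ≤ x → φ x = 0)
    {m : ℕ → ℝ} (hm : ∀ i : ℕ, (i : ℝ) ≤ m i) (hm' : ∀ i : ℕ, m i ≤ i + 1) :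
    Tendsto (fun h : ℝ => h * ∑' i, φ (h * m i)) (𝓝[>] 0) (𝓝 (∫ x in (0 : ℝ)..1, φ x)) := by
  rw [Metric.tendsto_nhds]
  intro η hη
  obtain ⟨δ, hδ, hφδ⟩ := Metric.uniformContinuousOn_iff.1
    (isCompact_Icc (a := (0 : ℝ)) (b := 2).uniformContinuousOn_of_continuous hφ.continuousOn)
    (η / 3) (by positivity)
  filter_upwards [Ioo_mem_nhdsGT (lt_min hδ one_pos)] with h ⟨hpos, hlt⟩
  obtain ⟨hhδ, hh1⟩ := lt_min_iff.1 hlt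
  have hN1 : 1 ≤ ⌈1 / h⌉₊ * h := (div_le_iff₀ hpos).1 (Nat.le_ceil _)
  have hN2 : ⌈1 / h⌉₊ * h ≤ 2 := by
    have := (lt_div_iff₀ hpos).1 (sub_lt_iff_lt_add.2 (Nat.ceil_lt_add_one (one_div_pos.2 hpos).le))
    linarith
  refine (abs_mul_tsum_sub_integral_le hφ h0 hm hm' hpos hN1 fun x hx y hy hxy => ?_).trans_lt
    (b := η / 3 * (⌈1 / h⌉₊ * h)) (by nlinarith)
  exact (hφδ x ⟨hx.1, hx.2.trans hN2⟩ y ⟨hy.1, hy.2.trans hN2⟩ (hxy.trans_lt hhδ)).le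

end RiemannSum

section PinskerWeight

variable {ι : Type*} {a : ι → ℝ}

/-- The weight `(1 - κ aₖ)₊` by which the Pinsker filter multiplies the `k`-th observation of a
scalar Gaussian sequence model with ellipsoid coefficients `a`. -/
def pinskerWeight (a : ι → ℝ) (κ : ℝ) (k : ι) : ℝ := max 0 (1 - κ * a k)

lemma pinskerWeight_nonneg (a : ι → ℝ) (κ : ℝ) (k : ι) : 0 ≤ pinskerWeight a κ k := le_max_left _ _

lemma pinskerWeight_le_one {κ : ℝ} {k : ι} (h : 0 ≤ κ * a k) : pinskerWeight a κ k ≤ 1 :=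
  max_le zero_le_one (by linarith)

lemma one_sub_pinskerWeight_le (a : ι → ℝ) (κ : ℝ) (k : ι) : 1 - pinskerWeight a κ k ≤ κ * a k := by
  linarith [le_max_right 0 (1 - κ * a k), pinskerWeight.eq_1 a κ k]

lemma pinskerWeight_mul_mul (a : ι → ℝ) (κ : ℝ) (k : ι) :
    pinskerWeight a κ k * (κ * a k) = pinskerWeight a κ k * (1 - pinskerWeight a κ k) := by
  unfold pinskerWeight
  rcases max_cases 0 (1 - κ * a k) with ⟨h, -⟩ | ⟨h, -⟩ <;> rw [h] <;> ring

lemma pinskerWeight_eq_zero {κ : ℝ} (hκ : 0 < κ) {k : ι} (h : κ⁻¹ ≤ a k) :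
    pinskerWeight a κ k = 0 :=
  max_eq_left (sub_nonpos.2 ((inv_le_iff_one_le_mul₀' hκ).1 h))

lemma finite_setOf_lt_of_tendsto_cofinite (ha : Tendsto a cofinite atTop) (t : ℝ) :
    {k | a k < t}.Finite := by
  simpa only [eventually_cofinite, not_le] using ha.eventually_ge_atTop t

lemma hasFiniteSupport_pinskerWeight (ha : Tendsto a cofinite atTop) {κ : ℝ} (hκ : 0 < κ) :
    (pinskerWeight a κ).HasFiniteSupport :=
  (finite_setOf_lt_of_tendsto_cofinite ha κ⁻¹).subset fun _ hk =>
    not_le.1 (mt (pinskerWeight_eq_zero hκ) hk)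

lemma summable_mul_pinskerWeight (ha : Tendsto a cofinite atTop) {κ : ℝ} (hκ : 0 < κ)
    (f : ι → ℝ) : Summable fun k => f k * pinskerWeight a κ k :=
  summable_of_hasFiniteSupport ((hasFiniteSupport_pinskerWeight ha hκ).mul_right f)

end PinskerWeight

section PinskerSum

variable {ι : Type*} {a v : ι → ℝ}

/-- In terms of `t = κ⁻¹`, the equation that determines the parameter `κ` of the Pinsker filter at
noise variances `ε² vₖ` is `ε² * pinskerSum a v t = 1`. -/
def pinskerSum (a v : ι → ℝ) (t : ℝ) : ℝ := ∑' k, v k * a k * max 0 (t - a k)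

lemma pinskerSum_inv (a v : ι → ℝ) {κ : ℝ} (hκ : 0 < κ) :
    pinskerSum a v κ⁻¹ = κ⁻¹ * ∑' k, v k * a k * pinskerWeight a κ k := by
  rw [pinskerSum, ← tsum_mul_left]
  refine tsum_congr fun k => ?_
  have : max 0 (κ⁻¹ - a k) = κ⁻¹ * pinskerWeight a κ k := by
    rw [pinskerWeight, mul_max_of_nonneg _ _ (inv_nonneg.2 hκ.le), mul_zero, mul_sub, mul_one,
      inv_mul_cancel_left₀ hκ.ne']
  rw [this]
  ring

lemma summable_pinskerSum (ha : Tendsto a cofinite atTop) (v : ι → ℝ) (t : ℝ) :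
    Summable fun k => v k * a k * max 0 (t - a k) :=
  summable_of_hasFiniteSupport <| (finite_setOf_lt_of_tendsto_cofinite ha t).subset fun k hk =>
    not_le.1 fun h : t ≤ a k => hk (by simp [max_eq_left (sub_nonpos.2 h)])

lemma pinskerSum_zero (ha : ∀ k, 0 ≤ a k) : pinskerSum a v 0 = 0 := by
  simp [pinskerSum, ha]

lemma continuous_pinskerSum (ha : Tendsto a cofinite atTop) : Continuous (pinskerSum a v) := by
  refine continuous_iff_continuousAt.2 fun t => ?_
  have hfin := finite_setOf_lt_of_tendsto_cofinite ha (t + 1)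
  have hsum : ∀ s < t + 1,
      pinskerSum a v s = ∑ k ∈ hfin.toFinset, v k * a k * max 0 (s - a k) := by
    refine fun s hs => tsum_eq_sum fun k hk => ?_
    have : t + 1 ≤ a k := by simpa using hk
    rw [max_eq_left (by linarith), mul_zero]
  have hcont : Continuous fun s => ∑ k ∈ hfin.toFinset, v k * a k * max 0 (s - a k) := by fun_prop
  refine hcont.continuousAt.congr ?_
  filter_upwards [eventually_lt_nhds (lt_add_one t)] with s hs
  exact (hsum s hs).symm

variable (ha : ∀ k, 0 ≤ a k) (hlim : Tendsto a cofinite atTop) (hv : ∀ k, 0 ≤ v k)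
include ha hlim hv

lemma monotone_pinskerSum : Monotone (pinskerSum a v) := fun s t hst =>
  (summable_pinskerSum hlim v s).tsum_le_tsum
    (fun k => by have := ha k; have := hv k; gcongr) (summable_pinskerSum hlim v t)

lemma mul_pinskerSum_le {c : ℝ} (hc : 1 ≤ c) (t : ℝ) :
    c * pinskerSum a v t ≤ pinskerSum a v (c * t) := by
  rw [pinskerSum, ← tsum_mul_left]
  refine ((summable_pinskerSum hlim v t).mul_left c).tsum_le_tsum (fun k => ?_)
    (summable_pinskerSum hlim v _)
  have hmax : c * max 0 (t - a k) ≤ max 0 (c * t - a k) := by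
    rw [mul_max_of_nonneg _ _ (by linarith), mul_zero]
    exact max_le_max_left 0 (by nlinarith [ha k])
  calc c * (v k * a k * max 0 (t - a k)) = v k * a k * (c * max 0 (t - a k)) := by ring
    _ ≤ v k * a k * max 0 (c * t - a k) :=
      mul_le_mul_of_nonneg_left hmax (mul_nonneg (hv k) (ha k))

lemma existsUnique_pinskerSum_eq (hpos : ∃ k, 0 < v k * a k) {c : ℝ} (hc : 0 < c) :
    ∃! t, 0 < t ∧ pinskerSum a v t = c := by
  refine existsUnique_of_exists_of_unique ?_ ?_
  · obtain ⟨k, hk⟩ := hpos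
    set t := a k + 1
    have ht : 0 < t := by linarith [ha k]
    have hGt : 0 < pinskerSum a v t :=
      (summable_pinskerSum hlim v t).tsum_pos
        (fun j => mul_nonneg (mul_nonneg (hv j) (ha j)) (le_max_left _ _)) k
        (by simpa [t] using hk)
    set r := max 1 (c / pinskerSum a v t)
    have hr : c ≤ pinskerSum a v (r * t) :=
      ((div_le_iff₀ hGt).1 (le_max_right _ _)).trans
        (mul_pinskerSum_le ha hlim hv (le_max_left _ _) t)
    obtain ⟨s, hs, hsc⟩ := intermediate_value_Icc (mul_nonneg (by positivity) ht.le)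
      (continuous_pinskerSum hlim).continuousOn
      (show c ∈ Set.Icc (pinskerSum a v 0) (pinskerSum a v (r * t)) from
        ⟨(pinskerSum_zero ha).trans_le hc.le, hr⟩)
    refine ⟨s, hs.1.lt_of_ne ?_, hsc⟩
    rintro rfl
    exact hc.ne ((pinskerSum_zero ha).symm.trans hsc)
  · have key : ∀ s t, 0 < s → pinskerSum a v s = c → pinskerSum a v t = c → ¬ s < t := by
      intro s t hs hGs hGt hst
      have := mul_pinskerSum_le ha hlim hv ((one_le_div hs).2 hst.le) s
      rw [div_mul_cancel₀ _ hs.ne', hGs, hGt] at this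
      nlinarith [(one_lt_div hs).2 hst]
    exact fun s t hs ht => le_antisymm (not_lt.1 (key t s ht.1 ht.2 hs.2))
      (not_lt.1 (key s t hs.1 hs.2 ht.2))

end PinskerSum

section StandardGaussian

/-- The law of a family, indexed by an arbitrary type, of independent standard Gaussian
variables. -/
def stdGaussianPi (ι : Type*) : Measure (ι → ℝ) := Measure.infinitePi fun _ => gaussianReal 0 1

instance (ι : Type*) : IsProbabilityMeasure (stdGaussianPi ι) := by
  unfold stdGaussianPi; infer_instance

variable {ι n : Type*}

lemma stdGaussianPi_eq_pi [Fintype n] :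
    stdGaussianPi n = Measure.pi fun _ : n => gaussianReal 0 1 :=
  Measure.infinitePi_eq_pi _

lemma iIndepFun_eval_stdGaussianPi :
    iIndepFun (fun (k : ι) (ξ : ι → ℝ) => ξ k) (stdGaussianPi ι) :=
  iIndepFun_infinitePi (P := fun _ : ι => gaussianReal 0 1) (X := fun _ x => x)
    fun _ => measurable_id

lemma measurePreserving_curry_stdGaussianPi :
    MeasurePreserving (MeasurableEquiv.curry ι n ℝ) (stdGaussianPi (ι × n))
      (Measure.infinitePi fun _ : ι => stdGaussianPi n) :=
  ⟨(MeasurableEquiv.curry ι n ℝ).measurable,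
    Measure.infinitePi_map_curry fun (_ : ι) (_ : n) => gaussianReal 0 1⟩

lemma measurePreserving_piCongrLeft_stdGaussianPi (e : ι ≃ n) :
    MeasurePreserving (MeasurableEquiv.piCongrLeft (fun _ => ℝ) e) (stdGaussianPi ι)
      (stdGaussianPi n) :=
  ⟨(MeasurableEquiv.piCongrLeft (fun _ => ℝ) e).measurable,
    Measure.infinitePi_map_piCongrLeft (fun _ : n => gaussianReal 0 1) e⟩

lemma measurePreserving_mulVec_stdGaussianPi [Fintype n] [DecidableEq n] {U : Matrix n n ℝ}
    (hU : U ∈ Matrix.orthogonalGroup n ℝ) :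
    MeasurePreserving (fun x => U *ᵥ x) (stdGaussianPi n) (stdGaussianPi n) := by
  have hmeas : Measurable fun x : n → ℝ => U *ᵥ x :=
    (Matrix.mulVecLin U).continuous_of_finiteDimensional.measurable
  refine ⟨hmeas, ?_⟩
  let e : EuclideanSpace ℝ n ≃ₗᵢ[ℝ] EuclideanSpace ℝ n :=
    Unitary.linearIsometryEquiv ⟨Matrix.toEuclideanCLM (𝕜 := ℝ) U, Unitary.map_mem _ hU⟩
  have he : (WithLp.toLp 2 : (n → ℝ) → EuclideanSpace ℝ n) ∘ (fun x => U *ᵥ x)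
      = e ∘ WithLp.toLp 2 := rfl
  rw [stdGaussianPi_eq_pi]
  apply (MeasurableEquiv.toLp 2 (n → ℝ)).map_measurableEquiv_injective
  change Measure.map (WithLp.toLp 2) _ = Measure.map (WithLp.toLp 2) _
  rw [Measure.map_map (by fun_prop) hmeas, he, ← Measure.map_map (by fun_prop) (by fun_prop),
    map_pi_eq_stdGaussian, stdGaussian_map]

lemma measurePreserving_infinitePi {X : ι → Type*} [∀ i, MeasurableSpace (X i)]
    {μ : ∀ i, Measure (X i)} [∀ i, IsProbabilityMeasure (μ i)] {f : ∀ i, X i → X i}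
    (hf : ∀ i, MeasurePreserving (f i) (μ i) (μ i)) :
    MeasurePreserving (fun x i => f i (x i)) (Measure.infinitePi μ) (Measure.infinitePi μ) := by
  refine ⟨measurable_pi_iff.2 fun i => (hf i).measurable.comp (measurable_pi_apply i), ?_⟩
  simp only [Measure.infinitePi_map_pi _ fun i => (hf i).measurable, (hf _).map_eq]

lemma measurePreserving_stdGaussianPi_prod :
    MeasurePreserving (fun x : ι → Fin 2 → ℝ => (fun k => x k 0, fun k => x k 1))
      (Measure.infinitePi fun _ : ι => stdGaussianPi (Fin 2))
      ((stdGaussianPi ι).prod (stdGaussianPi ι)) := by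
  have hpi : MeasurePreserving MeasurableEquiv.finTwoArrow
      (Measure.infinitePi fun _ : Fin 2 => stdGaussianPi ι)
      ((stdGaussianPi ι).prod (stdGaussianPi ι)) := by
    rw [Measure.infinitePi_eq_pi]
    exact measurePreserving_finTwoArrow _
  exact ((hpi.comp measurePreserving_curry_stdGaussianPi).comp
    (measurePreserving_piCongrLeft_stdGaussianPi (Equiv.prodComm ι (Fin 2)))).comp
    (measurePreserving_curry_stdGaussianPi.symm _)

lemma measurePreserving_rotation_stdGaussianPi {c s : ι → ℝ} (h : ∀ k, c k ^ 2 + s k ^ 2 = 1) :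
    MeasurePreserving (fun ω : (ι → ℝ) × (ι → ℝ) => (c * ω.1 + s * ω.2, c * ω.2 - s * ω.1))
      ((stdGaussianPi ι).prod (stdGaussianPi ι)) ((stdGaussianPi ι).prod (stdGaussianPi ι)) := by
  let R : ι → Matrix (Fin 2) (Fin 2) ℝ := fun k => !![c k, s k; -s k, c k]
  have hR : ∀ k, R k ∈ Matrix.orthogonalGroup (Fin 2) ℝ := fun k => by
    rw [Matrix.mem_orthogonalGroup_iff]
    ext i j
    fin_cases i <;> fin_cases j <;> simp [R, Matrix.mul_apply, Fin.sum_univ_two] <;>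
      linarith [h k]
  have hblocks := measurePreserving_infinitePi (ι := ι) (μ := fun _ => stdGaussianPi (Fin 2))
    fun k => measurePreserving_mulVec_stdGaussianPi (hR k)
  refine ⟨by fun_prop, ?_⟩
  conv_lhs => rw [← measurePreserving_stdGaussianPi_prod.map_eq]
  rw [← (measurePreserving_stdGaussianPi_prod.comp hblocks).map_eq, Measure.map_map (by fun_prop)
    measurePreserving_stdGaussianPi_prod.measurable]
  congr 1
  ext x k
  · simp [R, dotProduct, Fin.sum_univ_two]
  · simp [R, dotProduct, Fin.sum_univ_two]
    ring

end StandardGaussian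

section Moments

lemma lintegral_ofReal_sq {Ω : Type*} [MeasurableSpace Ω] {P : Measure Ω} [IsProbabilityMeasure P]
    {Y : Ω → ℝ} (hY : MemLp Y 2 P) :
    ∫⁻ ω, ENNReal.ofReal (Y ω ^ 2) ∂P = ENNReal.ofReal (Var[Y; P] + P[Y] ^ 2) := by
  rw [variance_eq_sub hY, sub_add_cancel, ← ofReal_integral_eq_lintegral_ofReal hY.integrable_sq
    (Eventually.of_forall fun _ => sq_nonneg _)]
  rfl

variable {ι : Type*}

lemma hasLaw_eval_stdGaussianPi (k : ι) :
    HasLaw (fun ξ : ι → ℝ => ξ k) (gaussianReal 0 1) (stdGaussianPi ι) :=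
  (measurePreserving_eval_infinitePi (fun _ : ι => gaussianReal 0 1) k).hasLaw

lemma integral_eval_stdGaussianPi (k : ι) : ∫ ξ, ξ k ∂stdGaussianPi ι = 0 := by
  rw [(hasLaw_eval_stdGaussianPi k).integral_eq, integral_id_gaussianReal]

lemma variance_eval_stdGaussianPi (k : ι) : Var[fun ξ : ι → ℝ => ξ k; stdGaussianPi ι] = 1 := by
  rw [(hasLaw_eval_stdGaussianPi k).variance_eq, variance_id_gaussianReal, NNReal.coe_one]

lemma integral_eval_sq_stdGaussianPi (k : ι) : ∫ ξ, ξ k ^ 2 ∂stdGaussianPi ι = 1 := by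
  rw [← variance_eval_stdGaussianPi k, variance_of_integral_eq_zero
    (measurable_pi_apply k).aemeasurable (integral_eval_stdGaussianPi k)]

lemma memLp_eval_stdGaussianPi (k : ι) {q : ℝ≥0∞} (hq : q ≠ ∞) :
    MemLp (fun ξ : ι → ℝ => ξ k) q (stdGaussianPi ι) :=
  (hasLaw_eval_stdGaussianPi k).hasGaussianLaw.memLp hq

lemma memLp_two_eval_sq_stdGaussianPi (k : ι) :
    MemLp (fun ξ : ι → ℝ => ξ k ^ 2) 2 (stdGaussianPi ι) := by
  have : ENNReal.HolderTriple 4 4 2 := ⟨by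
    rw [← two_mul, show (4 : ℝ≥0∞) = 2 * 2 by norm_num,
      ENNReal.mul_inv (Or.inl (by simp)) (Or.inl (by simp)), ← mul_assoc,
      ENNReal.mul_inv_cancel (by simp) (by simp), one_mul]⟩
  have hξ := memLp_eval_stdGaussianPi k (q := 4) (by simp)
  simp only [pow_two]
  exact hξ.mul hξ

lemma lintegral_ofReal_sq_affine_eval (b c : ℝ) (k : ι) :
    ∫⁻ ξ, ENNReal.ofReal ((c + b * ξ k) ^ 2) ∂stdGaussianPi ι
      = ENNReal.ofReal (b ^ 2 + c ^ 2) := by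
  have hξ := (memLp_eval_stdGaussianPi k (q := 2) (by simp)).const_mul b
  have hmean : ∫ ξ : ι → ℝ, (c + b * ξ k) ∂stdGaussianPi ι = c := by
    rw [integral_add (integrable_const c) (hξ.integrable one_le_two), integral_const_mul,
      integral_eval_stdGaussianPi]
    simp
  have hvar : Var[fun ξ : ι → ℝ => c + b * ξ k; stdGaussianPi ι] = b ^ 2 := by
    rw [variance_const_add hξ.aestronglyMeasurable, variance_const_mul,
      variance_eval_stdGaussianPi, mul_one]
  have hsq := lintegral_ofReal_sq ((memLp_const c).add hξ)
  simp only [Pi.add_def] at hsq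
  rw [hsq, hvar, hmean]

lemma variance_sum_mul_eval_sq (F : Finset ι) (w : ι → ℝ) :
    Var[∑ k ∈ F, fun ξ : ι → ℝ => w k * ξ k ^ 2; stdGaussianPi ι]
      = Var[fun x => x ^ 2; gaussianReal 0 1] * ∑ k ∈ F, w k ^ 2 := by
  rw [IndepFun.variance_sum fun k _ => (memLp_two_eval_sq_stdGaussianPi k).const_mul _,
    Finset.mul_sum]
  · refine Finset.sum_congr rfl fun k _ => ?_
    rw [variance_const_mul, mul_comm, ← (hasLaw_eval_stdGaussianPi k).map_eq,
      variance_map (X := fun x : ℝ => x ^ 2)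
      (by fun_prop) (measurable_pi_apply k).aemeasurable]
    rfl
  · exact fun k _ l _ hkl => (iIndepFun_eval_stdGaussianPi.indepFun hkl).comp
      (φ := fun x => w k * x ^ 2) (ψ := fun x => w l * x ^ 2) (by fun_prop) (by fun_prop)

lemma lintegral_ofReal_sq_sum_mul_eval_sq_sub (F : Finset ι) (w : ι → ℝ) :
    ∫⁻ ξ, ENNReal.ofReal ((∑ k ∈ F, w k * ξ k ^ 2 - ∑ k ∈ F, w k) ^ 2) ∂stdGaussianPi ι
      = ENNReal.ofReal (Var[fun x => x ^ 2; gaussianReal 0 1] * ∑ k ∈ F, w k ^ 2) := by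
  have hmem : ∀ k ∈ F, MemLp (fun ξ : ι → ℝ => w k * ξ k ^ 2) 2 (stdGaussianPi ι) :=
    fun k _ => (memLp_two_eval_sq_stdGaussianPi k).const_mul _
  have hsum := memLp_finsetSum F hmem
  have hmean : ∫ ξ, ∑ k ∈ F, w k * ξ k ^ 2 ∂stdGaussianPi ι = ∑ k ∈ F, w k := by
    rw [integral_finsetSum _ fun k hk => (hmem k hk).integrable one_le_two]
    simp only [integral_const_mul, integral_eval_sq_stdGaussianPi, mul_one]
  have hsq := lintegral_ofReal_sq (hsum.sub (memLp_const (∑ k ∈ F, w k)))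
  simp only [Pi.sub_def] at hsq
  rw [hsq, variance_sub_const hsum.aestronglyMeasurable, integral_sub (hsum.integrable one_le_two)
    (integrable_const _), hmean, ← variance_sum_mul_eval_sq, Finset.sum_fn]
  simp

end Moments

section SequenceModel

variable {ι : Type*}

/-- The squared `ℓ²` distance, possibly infinite: the loss in a scalar sequence model. -/
def sqLoss (θ t : ι → ℝ) : ℝ≥0∞ := ∑' k, ENNReal.ofReal ((t k - θ k) ^ 2)

/-- The ellipsoid `∑ₖ aₖ² θₖ² ≤ 1`, the parameter space in a scalar sequence model. -/
def ellipsoid (a : ι → ℝ) : Set (ι → ℝ) := {θ | ∑' k, ENNReal.ofReal (a k ^ 2 * θ k ^ 2) ≤ 1}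

/-- The risk at `θ` of the estimator `f` in the scalar sequence model `yₖ = θₖ + σₖ ξₖ` with
independent standard Gaussian noise `ξ`. -/
def seqRisk (σ θ : ι → ℝ) (f : (ι → ℝ) → ι → ℝ) : ℝ≥0∞ :=
  ∫⁻ ξ, sqLoss θ (f (θ + σ * ξ)) ∂stdGaussianPi ι

section UpperBound

variable [Countable ι]

lemma seqRisk_mul (σ θ w : ι → ℝ) :
    seqRisk σ θ (fun y => w * y)
      = ∑' k, ENNReal.ofReal (σ k ^ 2 * w k ^ 2 + (1 - w k) ^ 2 * θ k ^ 2) := by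
  unfold seqRisk sqLoss
  have hmeas : ∀ k, Measurable fun ξ : ι → ℝ =>
      ENNReal.ofReal (((w * (θ + σ * ξ)) k - θ k) ^ 2) := fun k => by
    simp only [Pi.mul_apply, Pi.add_apply]
    fun_prop
  rw [lintegral_tsum fun k => (hmeas k).aemeasurable]
  refine tsum_congr fun k => ?_
  calc ∫⁻ ξ, ENNReal.ofReal (((w * (θ + σ * ξ)) k - θ k) ^ 2) ∂stdGaussianPi ι
      = ∫⁻ ξ, ENNReal.ofReal ((-((1 - w k) * θ k) + σ k * w k * ξ k) ^ 2) ∂stdGaussianPi ι := by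
        refine lintegral_congr fun ξ => ?_
        simp only [Pi.mul_apply, Pi.add_apply]
        ring_nf
    _ = ENNReal.ofReal (σ k ^ 2 * w k ^ 2 + (1 - w k) ^ 2 * θ k ^ 2) := by
        rw [lintegral_ofReal_sq_affine_eval, neg_sq, mul_pow, mul_pow]

variable {a σ : ι → ℝ} {κ : ℝ} (ha : ∀ k, 0 ≤ a k) (hlim : Tendsto a cofinite atTop) (hκ : 0 < κ)
  (hroot : ∑' k, σ k ^ 2 * a k * pinskerWeight a κ k = κ)
include ha hlim hκ hroot

omit [Countable ι] ha in
lemma tsum_sq_mul_sq_pinskerWeight_add :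
    ∑' k, σ k ^ 2 * pinskerWeight a κ k ^ 2 + κ ^ 2 = ∑' k, σ k ^ 2 * pinskerWeight a κ k := by
  have hsum := fun f : ι → ℝ => summable_mul_pinskerWeight hlim hκ f
  have hbias : κ ^ 2
      = ∑' k, σ k ^ 2 * (1 - pinskerWeight a κ k) * pinskerWeight a κ k := by
    rw [sq]
    nth_rw 2 [← hroot]
    rw [← tsum_mul_left]
    refine tsum_congr fun k => ?_
    linear_combination σ k ^ 2 * pinskerWeight_mul_mul a κ k
  have hvar : ∀ k, σ k ^ 2 * pinskerWeight a κ k ^ 2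
      = σ k ^ 2 * pinskerWeight a κ k * pinskerWeight a κ k := fun k => by ring
  rw [hbias, tsum_congr hvar, ← (hsum _).tsum_add (hsum _)]
  exact tsum_congr fun k => by ring

theorem seqRisk_pinskerWeight_le {θ : ι → ℝ} (hθ : θ ∈ ellipsoid a) :
    seqRisk σ θ (fun y => pinskerWeight a κ * y)
      ≤ ENNReal.ofReal (∑' k, σ k ^ 2 * pinskerWeight a κ k) := by
  have hle : ∀ k, ENNReal.ofReal (σ k ^ 2 * pinskerWeight a κ k ^ 2
      + (1 - pinskerWeight a κ k) ^ 2 * θ k ^ 2)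
      ≤ ENNReal.ofReal (σ k ^ 2 * pinskerWeight a κ k ^ 2)
        + ENNReal.ofReal (κ ^ 2) * ENNReal.ofReal (a k ^ 2 * θ k ^ 2) := fun k => by
    have hw : 0 ≤ 1 - pinskerWeight a κ k :=
      sub_nonneg.2 (pinskerWeight_le_one (mul_nonneg hκ.le (ha k)))
    have hbias : (1 - pinskerWeight a κ k) ^ 2 ≤ (κ * a k) ^ 2 := by
      gcongr
      exact one_sub_pinskerWeight_le a κ k
    rw [← ENNReal.ofReal_mul (by positivity), ← ENNReal.ofReal_add (by positivity) (by positivity),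
      ← mul_assoc, ← mul_pow κ]
    gcongr
  have hsum : Summable fun k => σ k ^ 2 * pinskerWeight a κ k ^ 2 :=
    (summable_mul_pinskerWeight hlim hκ fun k => σ k ^ 2 * pinskerWeight a κ k).congr
      fun k => by ring
  calc seqRisk σ θ (fun y => pinskerWeight a κ * y)
      ≤ ∑' k, (ENNReal.ofReal (σ k ^ 2 * pinskerWeight a κ k ^ 2)
        + ENNReal.ofReal (κ ^ 2) * ENNReal.ofReal (a k ^ 2 * θ k ^ 2)) :=
        (seqRisk_mul _ _ _).trans_le (ENNReal.tsum_le_tsum hle)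
    _ = ENNReal.ofReal (∑' k, σ k ^ 2 * pinskerWeight a κ k ^ 2)
        + ENNReal.ofReal (κ ^ 2) * ∑' k, ENNReal.ofReal (a k ^ 2 * θ k ^ 2) := by
        rw [ENNReal.tsum_add, ENNReal.tsum_mul_left,
          ENNReal.ofReal_tsum_of_nonneg (fun k => by positivity) hsum]
    _ ≤ ENNReal.ofReal (∑' k, σ k ^ 2 * pinskerWeight a κ k ^ 2) + ENNReal.ofReal (κ ^ 2) * 1 := by
        gcongr
        exact hθ
    _ = ENNReal.ofReal (∑' k, σ k ^ 2 * pinskerWeight a κ k) := by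
        rw [mul_one, ← ENNReal.ofReal_add (tsum_nonneg fun k => by positivity) (by positivity),
          tsum_sq_mul_sq_pinskerWeight_add hlim hκ hroot]

end UpperBound

section Bayes

lemma ofReal_le_lintegral_sq_sub_of_gaussian_prior {σ τ : ι → ℝ} (h : ∀ k, 0 < τ k ^ 2 + σ k ^ 2)
    {T : (ι → ℝ) → ℝ} (hT : Measurable T) (k : ι) :
    ENNReal.ofReal (σ k ^ 2 * τ k ^ 2 / (τ k ^ 2 + σ k ^ 2))
      ≤ ∫⁻ ω, ENNReal.ofReal ((T (τ * ω.1 + σ * ω.2) - τ k * ω.1 k) ^ 2)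
        ∂(stdGaussianPi ι).prod (stdGaussianPi ι) := by
  set r : ι → ℝ := fun k => √(τ k ^ 2 + σ k ^ 2)
  have hr : ∀ k, r k ≠ 0 := fun k => (Real.sqrt_pos.2 (h k)).ne'
  have hr2 : ∀ k, r k ^ 2 = τ k ^ 2 + σ k ^ 2 := fun k => Real.sq_sqrt (h k).le
  -- In the rotated coordinates the observation is a function of the first component alone.
  have hrot := measurePreserving_rotation_stdGaussianPi (c := τ / r) (s := -(σ / r)) fun k => by
    simp only [Pi.div_apply, Pi.neg_apply, neg_sq, div_pow, hr2]
    rw [← add_div, div_self (h k).ne']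
  have hobs : ∀ η ζ : ι → ℝ,
      τ * (τ / r * η + -(σ / r) * ζ) + σ * (τ / r * ζ - -(σ / r) * η) = r * η := fun η ζ => by
    ext j
    simp only [Pi.add_apply, Pi.mul_apply, Pi.div_apply, Pi.neg_apply, Pi.sub_apply]
    field_simp [hr j]
    linear_combination -η j * hr2 j
  have hmeas : Measurable fun ω : (ι → ℝ) × (ι → ℝ) =>
      ENNReal.ofReal ((T (τ * ω.1 + σ * ω.2) - τ k * ω.1 k) ^ 2) := by fun_prop
  have hcond : ∀ η : ι → ℝ, ENNReal.ofReal (σ k ^ 2 * τ k ^ 2 / (τ k ^ 2 + σ k ^ 2))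
      ≤ ∫⁻ ζ, ENNReal.ofReal ((T (r * η) - τ k * (τ / r * η + -(σ / r) * ζ) k) ^ 2)
        ∂stdGaussianPi ι := fun η => by
    calc ENNReal.ofReal (σ k ^ 2 * τ k ^ 2 / (τ k ^ 2 + σ k ^ 2))
        = ENNReal.ofReal ((τ k * (σ k / r k)) ^ 2) := by
          rw [mul_pow, div_pow, hr2]
          ring_nf
      _ ≤ ENNReal.ofReal ((τ k * (σ k / r k)) ^ 2
            + (T (r * η) - τ k * (τ k / r k * η k)) ^ 2) :=
          ENNReal.ofReal_le_ofReal (le_add_of_nonneg_right (sq_nonneg _))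
      _ = _ := by
          rw [← lintegral_ofReal_sq_affine_eval _ _ k]
          refine lintegral_congr fun ζ => ?_
          simp only [Pi.add_apply, Pi.mul_apply, Pi.div_apply, Pi.neg_apply]
          ring_nf
  rw [← hrot.lintegral_comp hmeas, ← Function.comp_def]
  refine le_of_le_of_eq ?_ (lintegral_prod _ (hmeas.comp hrot.measurable).aemeasurable).symm
  simp only [Function.comp_apply, hobs]
  simpa only [lintegral_const, measure_univ, mul_one] using
    lintegral_mono (μ := stdGaussianPi ι) hcond

lemma ofReal_sum_bayesRisk_le_lintegral {σ τ : ι → ℝ} (h : ∀ k, 0 < τ k ^ 2 + σ k ^ 2)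
    {T : (ι → ℝ) → ι → ℝ} (hT : Measurable T) (F : Finset ι) :
    ENNReal.ofReal (∑ k ∈ F, σ k ^ 2 * τ k ^ 2 / (τ k ^ 2 + σ k ^ 2))
      ≤ ∫⁻ η, ∫⁻ ξ, ENNReal.ofReal (∑ k ∈ F, (T (τ * η + σ * ξ) k - (τ * η) k) ^ 2)
        ∂stdGaussianPi ι ∂stdGaussianPi ι := by
  have hmeas : ∀ k, Measurable fun ω : (ι → ℝ) × (ι → ℝ) =>
      ENNReal.ofReal ((T (τ * ω.1 + σ * ω.2) k - τ k * ω.1 k) ^ 2) := fun k => by fun_prop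
  rw [ENNReal.ofReal_sum_of_nonneg fun k _ => by have := h k; positivity]
  simp only [ENNReal.ofReal_sum_of_nonneg fun _ _ => sq_nonneg _]
  calc ∑ k ∈ F, ENNReal.ofReal (σ k ^ 2 * τ k ^ 2 / (τ k ^ 2 + σ k ^ 2))
      ≤ ∑ k ∈ F, ∫⁻ ω, ENNReal.ofReal ((T (τ * ω.1 + σ * ω.2) k - τ k * ω.1 k) ^ 2)
          ∂(stdGaussianPi ι).prod (stdGaussianPi ι) :=
        Finset.sum_le_sum fun k _ => ofReal_le_lintegral_sq_sub_of_gaussian_prior h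
          ((measurable_pi_apply k).comp hT) k
    _ = _ := by
        rw [← lintegral_finsetSum _ fun k _ => hmeas k,
          lintegral_prod _ (Finset.measurable_sum _ fun k _ => hmeas k).aemeasurable]
        rfl

end Bayes

end SequenceModel

section LowerBound

variable {ι : Type*}

/-- The sequence `t`, replaced by `0` if `∑ₖ tₖ²` exceeds `r` over `F`. Truncating an estimator of a
small parameter in this way bounds its loss without increasing it. -/
def truncate (F : Finset ι) (r : ℝ) (t : ι → ℝ) : ι → ℝ := if ∑ k ∈ F, t k ^ 2 ≤ r then t else 0

lemma measurable_truncate (F : Finset ι) (r : ℝ) : Measurable (truncate F r) :=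
  Measurable.ite (measurableSet_le (by fun_prop) measurable_const) measurable_id measurable_const

lemma sum_sq_truncate_sub_le {F : Finset ι} {r : ℝ} {θ : ι → ℝ} (hθ : 4 * ∑ k ∈ F, θ k ^ 2 ≤ r)
    (t : ι → ℝ) : ∑ k ∈ F, (truncate F r t k - θ k) ^ 2 ≤ ∑ k ∈ F, (t k - θ k) ^ 2 := by
  unfold truncate
  split_ifs with ht
  · rfl
  · have hsq : ∑ k ∈ F, t k ^ 2 ≤ 2 * ∑ k ∈ F, (t k - θ k) ^ 2 + 2 * ∑ k ∈ F, θ k ^ 2 := by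
      rw [Finset.mul_sum, Finset.mul_sum, ← Finset.sum_add_distrib]
      exact Finset.sum_le_sum fun k _ => by nlinarith [sq_nonneg (t k - θ k - θ k)]
    simp only [Pi.zero_apply, zero_sub, neg_sq]
    linarith

lemma sum_sq_truncate_sub_le_add {F : Finset ι} {r : ℝ} (hr : 0 ≤ r) (θ t : ι → ℝ) :
    ∑ k ∈ F, (truncate F r t k - θ k) ^ 2 ≤ 2 * r + 2 * ∑ k ∈ F, θ k ^ 2 := by
  have hsq : ∑ k ∈ F, (truncate F r t k - θ k) ^ 2
      ≤ 2 * ∑ k ∈ F, truncate F r t k ^ 2 + 2 * ∑ k ∈ F, θ k ^ 2 := by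
    rw [Finset.mul_sum, Finset.mul_sum, ← Finset.sum_add_distrib]
    exact Finset.sum_le_sum fun k _ => by nlinarith [sq_nonneg (truncate F r t k + θ k)]
  have hbdd : ∑ k ∈ F, truncate F r t k ^ 2 ≤ r := by
    unfold truncate
    split_ifs with ht
    · exact ht
    · simpa using hr
  linarith

lemma ofReal_sum_sq_le_sqLoss (F : Finset ι) (θ t : ι → ℝ) :
    ENNReal.ofReal (∑ k ∈ F, (t k - θ k) ^ 2) ≤ sqLoss θ t := by
  rw [ENNReal.ofReal_sum_of_nonneg fun k _ => sq_nonneg _]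
  exact ENNReal.sum_le_tsum F

lemma mem_ellipsoid_of_sum_le {a θ : ι → ℝ} {F : Finset ι} (hF : ∀ k ∉ F, θ k = 0)
    (h : ∑ k ∈ F, a k ^ 2 * θ k ^ 2 ≤ 1) : θ ∈ ellipsoid a := by
  change ∑' k, ENNReal.ofReal (a k ^ 2 * θ k ^ 2) ≤ 1
  rw [tsum_eq_sum fun k hk => by simp [hF k hk],
    ← ENNReal.ofReal_sum_of_nonneg fun k _ => by positivity]
  exact ENNReal.ofReal_le_one.2 h

variable {a σ : ι → ℝ} {F : Finset ι} {α δ : ℝ} (hα : 0 < α) (haF : ∀ k ∈ F, α ≤ a k) (hδ : 0 < δ)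
include hα haF

omit hδ in
lemma sum_sq_le_sum_mul_sq_div (θ : ι → ℝ) :
    ∑ k ∈ F, θ k ^ 2 ≤ (∑ k ∈ F, a k ^ 2 * θ k ^ 2) / α ^ 2 := by
  rw [le_div_iff₀ (by positivity), Finset.sum_mul]
  refine Finset.sum_le_sum fun k hk => ?_
  rw [mul_comm]
  have := haF k hk
  gcongr

include hδ

-- Outside the ellipsoid the loss of the truncated estimator is at most quadratic in the
-- deviation of `∑ₖ aₖ² θₖ²` from `m`, so that a variance will control it.
lemma lintegral_sum_sq_truncate_sub_le {m : ℝ} (hm0 : 0 ≤ m) (hm : m ≤ 1 - δ) {θ : ι → ℝ}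
    (hθ : ∀ k ∉ F, θ k = 0) (f : (ι → ℝ) → ι → ℝ) :
    ∫⁻ ξ, ENNReal.ofReal (∑ k ∈ F, (truncate F (4 / α ^ 2) (f (θ + σ * ξ)) k - θ k) ^ 2)
        ∂stdGaussianPi ι
      ≤ (⨆ θ ∈ ellipsoid a, seqRisk σ θ f)
        + ENNReal.ofReal (10 / (α * δ) ^ 2 * (∑ k ∈ F, a k ^ 2 * θ k ^ 2 - m) ^ 2) := by
  set X := ∑ k ∈ F, a k ^ 2 * θ k ^ 2
  have hθX : ∑ k ∈ F, θ k ^ 2 ≤ X / α ^ 2 := sum_sq_le_sum_mul_sq_div hα haF θ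
  rcases le_or_gt X 1 with hX | hX
  · have hsmall : 4 * ∑ k ∈ F, θ k ^ 2 ≤ 4 / α ^ 2 := by
      calc 4 * ∑ k ∈ F, θ k ^ 2 ≤ 4 * (1 / α ^ 2) := by gcongr; exact hθX.trans (by gcongr)
        _ = 4 / α ^ 2 := by ring
    refine le_add_right (le_iSup₂_of_le θ (mem_ellipsoid_of_sum_le hθ hX) ?_)
    exact lintegral_mono fun ξ => (ENNReal.ofReal_le_ofReal
      (sum_sq_truncate_sub_le hsmall _)).trans (ofReal_sum_sq_le_sqLoss F _ _)
  · have hdev : δ ^ 2 * X ≤ (X - m) ^ 2 := by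
      calc δ ^ 2 * X ≤ (δ * X) ^ 2 := by nlinarith [sq_nonneg δ]
        _ ≤ (X - m) ^ 2 := by
          gcongr
          nlinarith
    have hloss : ∀ t, ∑ k ∈ F, (truncate F (4 / α ^ 2) t k - θ k) ^ 2
        ≤ 10 / (α * δ) ^ 2 * (X - m) ^ 2 := fun t => by
      calc ∑ k ∈ F, (truncate F (4 / α ^ 2) t k - θ k) ^ 2
          ≤ 2 * (4 / α ^ 2) + 2 * ∑ k ∈ F, θ k ^ 2 :=
            sum_sq_truncate_sub_le_add (by positivity) θ t
        _ ≤ 2 * (4 / α ^ 2 * X) + 2 * (X / α ^ 2) := by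
          gcongr
          exact le_mul_of_one_le_right (by positivity) hX.le
        _ = 10 / (α * δ) ^ 2 * (δ ^ 2 * X) := by field_simp; ring
        _ ≤ 10 / (α * δ) ^ 2 * (X - m) ^ 2 := by gcongr
    refine le_add_left ((lintegral_mono fun ξ => ENNReal.ofReal_le_ofReal (hloss _)).trans ?_)
    rw [lintegral_const, measure_univ, mul_one]

theorem ofReal_sum_bayesRisk_le_iSup_seqRisk_add {s : ι → ℝ} (hs : ∀ k, 0 ≤ s k)
    (hprior : ∑ k ∈ F, a k ^ 2 * s k ≤ 1 - δ) (hσ : ∀ k, σ k ≠ 0)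
    {f : (ι → ℝ) → ι → ℝ} (hf : Measurable f) :
    ENNReal.ofReal (∑ k ∈ F, σ k ^ 2 * s k / (s k + σ k ^ 2))
      ≤ (⨆ θ ∈ ellipsoid a, seqRisk σ θ f)
        + ENNReal.ofReal (10 / (α * δ) ^ 2 * (Var[fun x => x ^ 2; gaussianReal 0 1]
          * ∑ k ∈ F, (a k ^ 2 * s k) ^ 2)) := by
  set τ : ι → ℝ := (F : Set ι).indicator fun k => √(s k)
  have hτs : ∀ G : ι → ℝ → ℝ, ∑ k ∈ F, G k (s k) = ∑ k ∈ F, G k (τ k ^ 2) :=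
    fun G => Finset.sum_congr rfl fun k hk => by
      simp only [τ, Set.indicator_of_mem (Finset.mem_coe.2 hk), Real.sq_sqrt (hs k)]
  have hg : Measurable fun y => truncate F (4 / α ^ 2) (f y) :=
    (measurable_truncate F _).comp hf
  rw [hτs fun k x => σ k ^ 2 * x / (x + σ k ^ 2), hτs fun k x => (a k ^ 2 * x) ^ 2]
  rw [hτs fun k x => a k ^ 2 * x] at hprior
  calc ENNReal.ofReal (∑ k ∈ F, σ k ^ 2 * τ k ^ 2 / (τ k ^ 2 + σ k ^ 2))
      ≤ ∫⁻ η, ∫⁻ ξ, ENNReal.ofReal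
          (∑ k ∈ F, (truncate F (4 / α ^ 2) (f (τ * η + σ * ξ)) k - (τ * η) k) ^ 2)
          ∂stdGaussianPi ι ∂stdGaussianPi ι :=
        ofReal_sum_bayesRisk_le_lintegral (fun k => by have := hσ k; positivity) hg F
    _ ≤ ∫⁻ η, (⨆ θ ∈ ellipsoid a, seqRisk σ θ f) + ENNReal.ofReal (10 / (α * δ) ^ 2
          * (∑ k ∈ F, a k ^ 2 * τ k ^ 2 * η k ^ 2 - ∑ k ∈ F, a k ^ 2 * τ k ^ 2) ^ 2)
          ∂stdGaussianPi ι := by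
        refine lintegral_mono fun η => ?_
        simpa only [Pi.mul_apply, mul_pow, mul_assoc] using lintegral_sum_sq_truncate_sub_le
          hα haF hδ (Finset.sum_nonneg fun k _ => by positivity) hprior
          (θ := τ * η) (fun k hk => by simp [τ, hk]) f
    _ = _ := by
        simp_rw [ENNReal.ofReal_mul (p := 10 / (α * δ) ^ 2) (by positivity)]
        rw [lintegral_add_left measurable_const, lintegral_const, measure_univ, mul_one,
          lintegral_const_mul _ (by fun_prop), lintegral_ofReal_sq_sum_mul_eval_sq_sub]

end LowerBound

section PinskerPrior

variable {ι : Type*} {a σ : ι → ℝ} {δ κ : ℝ}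

/-- The variance of the `k`-th coordinate under the Gaussian prior that is least favourable for
noise levels `σ` and an ellipsoid with coefficients `a`, shrunk by the factor `1 - δ` so that the
prior concentrates on the ellipsoid. -/
def pinskerPriorVar (a σ : ι → ℝ) (δ κ : ℝ) (k : ι) : ℝ :=
  (1 - δ) * (σ k ^ 2 * pinskerWeight a κ k) / (κ * a k)

lemma pinskerPriorVar_nonneg (hδ : δ ≤ 1) {k : ι} (h : 0 ≤ κ * a k) :
    0 ≤ pinskerPriorVar a σ δ κ k :=
  div_nonneg (mul_nonneg (by linarith) (mul_nonneg (sq_nonneg _) (pinskerWeight_nonneg a κ k))) h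

lemma sq_mul_pinskerPriorVar (a σ : ι → ℝ) (δ κ : ℝ) (k : ι) :
    a k ^ 2 * pinskerPriorVar a σ δ κ k
      = (1 - δ) / κ * (σ k ^ 2 * a k * pinskerWeight a κ k) := by
  rcases eq_or_ne (a k) 0 with h | h
  · simp [h]
  · rw [pinskerPriorVar]
    field_simp

lemma sq_mul_pinskerPriorVar_le (hδ0 : 0 ≤ δ) (hκ : 0 < κ) {k : ι} (h : 0 ≤ a k) :
    a k ^ 2 * pinskerPriorVar a σ δ κ k ≤ σ k ^ 2 / κ ^ 2 := by
  have := pinskerWeight_nonneg a κ k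
  have hw : pinskerWeight a κ k * (κ * a k) ≤ 1 := by
    rw [pinskerWeight_mul_mul]
    nlinarith [sq_nonneg (pinskerWeight a κ k - 1 / 2)]
  calc a k ^ 2 * pinskerPriorVar a σ δ κ k
      = (1 - δ) * (σ k ^ 2 / κ ^ 2 * (pinskerWeight a κ k * (κ * a k))) := by
        rw [sq_mul_pinskerPriorVar]
        field_simp
    _ ≤ 1 * (σ k ^ 2 / κ ^ 2 * 1) := by
        gcongr
        linarith
    _ = σ k ^ 2 / κ ^ 2 := by ring

lemma le_bayesRisk_pinskerPriorVar (hδ0 : 0 ≤ δ) (hδ1 : δ ≤ 1) {k : ι} (hκa : 0 < κ * a k)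
    (hσ : σ k ≠ 0) :
    (1 - δ) * (σ k ^ 2 * pinskerWeight a κ k)
      ≤ σ k ^ 2 * pinskerPriorVar a σ δ κ k / (pinskerPriorVar a σ δ κ k + σ k ^ 2) := by
  set s := pinskerPriorVar a σ δ κ k
  have hs : 0 ≤ s := pinskerPriorVar_nonneg hδ1 hκa.le
  have hsw : (1 - δ) * (σ k ^ 2 * pinskerWeight a κ k) = s * (κ * a k) :=
    (div_mul_cancel₀ _ hκa.ne').symm
  rcases (pinskerWeight_nonneg a κ k).eq_or_lt with hw | hw
  · rw [← hw, mul_zero, mul_zero]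
    positivity
  · have hκw : κ * a k = 1 - pinskerWeight a κ k :=
      mul_left_cancel₀ hw.ne' (pinskerWeight_mul_mul a κ k)
    have hden : s * (κ * a k) + κ * a k * σ k ^ 2 ≤ σ k ^ 2 := by
      rw [← hsw, hκw]
      nlinarith [mul_nonneg hδ0 (mul_nonneg (sq_nonneg (σ k)) hw.le)]
    rw [hsw, le_div_iff₀ (by positivity)]
    calc s * (κ * a k) * (s + σ k ^ 2) = s * (s * (κ * a k) + κ * a k * σ k ^ 2) := by ring
      _ ≤ s * σ k ^ 2 := by gcongr
      _ = σ k ^ 2 * s := mul_comm _ _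

lemma tsum_sub_sum_le_sum_sdiff [DecidableEq ι] {w v : ι → ℝ} {S E : Finset ι}
    (hS : ∀ k ∉ S, w k = 0) (hv : ∀ k, 0 ≤ v k) (hw : ∀ k, w k ≤ 1) :
    ∑' k, v k * w k - ∑ k ∈ E, v k ≤ ∑ k ∈ S \ E, v k * w k := by
  have hle : ∑ k ∈ E, v k * w k ≤ ∑ k ∈ E, v k :=
    Finset.sum_le_sum fun k _ => mul_le_of_le_one_right (hv k) (hw k)
  have hdisj := Finset.sum_sdiff (f := fun k => v k * w k)
    (Finset.subset_union_right (s₁ := S) (s₂ := E))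
  rw [Finset.union_sdiff_right] at hdisj
  rw [tsum_eq_sum (s := S ∪ E) fun k hk => by simp [hS k (by simp_all)]]
  linarith

lemma sum_sq_mul_pinskerPriorVar_le (ha : ∀ k, 0 ≤ a k) (hlim : Tendsto a cofinite atTop)
    (hδ1 : δ ≤ 1) (hκ : 0 < κ) (hroot : ∑' k, σ k ^ 2 * a k * pinskerWeight a κ k = κ)
    (F : Finset ι) : ∑ k ∈ F, a k ^ 2 * pinskerPriorVar a σ δ κ k ≤ 1 - δ := by
  simp only [sq_mul_pinskerPriorVar]
  rw [← Finset.mul_sum]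
  calc (1 - δ) / κ * ∑ k ∈ F, σ k ^ 2 * a k * pinskerWeight a κ k
      ≤ (1 - δ) / κ * ∑' k, σ k ^ 2 * a k * pinskerWeight a κ k := by
        have hsum := summable_mul_pinskerWeight hlim hκ fun k => σ k ^ 2 * a k
        have hnonneg := fun k => mul_nonneg (mul_nonneg (sq_nonneg (σ k)) (ha k))
          (pinskerWeight_nonneg a κ k)
        exact mul_le_mul_of_nonneg_left (hsum.sum_le_tsum F fun k _ => hnonneg k)
          (div_nonneg (sub_nonneg.2 hδ1) hκ.le)
    _ = 1 - δ := by rw [hroot, div_mul_cancel₀ _ hκ.ne']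

lemma sum_sq_sq_mul_pinskerPriorVar_le (ha : ∀ k, 0 ≤ a k) (hlim : Tendsto a cofinite atTop)
    (hδ0 : 0 ≤ δ) (hδ1 : δ ≤ 1) {b : ℝ} (hb0 : 0 ≤ b) (hb : ∀ k, σ k ^ 2 ≤ b) (hκ : 0 < κ)
    (hroot : ∑' k, σ k ^ 2 * a k * pinskerWeight a κ k = κ) (F : Finset ι) :
    ∑ k ∈ F, (a k ^ 2 * pinskerPriorVar a σ δ κ k) ^ 2 ≤ b / κ ^ 2 := by
  calc ∑ k ∈ F, (a k ^ 2 * pinskerPriorVar a σ δ κ k) ^ 2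
      ≤ ∑ k ∈ F, b / κ ^ 2 * (a k ^ 2 * pinskerPriorVar a σ δ κ k) := by
        refine Finset.sum_le_sum fun k _ => ?_
        rw [sq]
        refine mul_le_mul_of_nonneg_right ?_ (mul_nonneg (sq_nonneg _)
          (pinskerPriorVar_nonneg hδ1 (mul_nonneg hκ.le (ha k))))
        exact (sq_mul_pinskerPriorVar_le hδ0 hκ (ha k)).trans (by gcongr; exact hb k)
    _ ≤ b / κ ^ 2 * 1 := by
        rw [← Finset.mul_sum]
        gcongr
        linarith [sum_sq_mul_pinskerPriorVar_le ha hlim hδ1 hκ hroot F]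
    _ = b / κ ^ 2 := mul_one _

theorem ofReal_le_iSup_seqRisk_add {E : Finset ι} (ha : ∀ k, 0 ≤ a k)
    (hlim : Tendsto a cofinite atTop) {α : ℝ} (hα : 0 < α) (hE : ∀ k ∉ E, α ≤ a k)
    (hδ0 : 0 < δ) (hδ1 : δ ≤ 1) {b : ℝ} (hσ : ∀ k, σ k ≠ 0) (hb : ∀ k, σ k ^ 2 ≤ b) (hκ : 0 < κ)
    (hroot : ∑' k, σ k ^ 2 * a k * pinskerWeight a κ k = κ)
    {f : (ι → ℝ) → ι → ℝ} (hf : Measurable f) :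
    ENNReal.ofReal ((1 - δ) * (∑' k, σ k ^ 2 * pinskerWeight a κ k - ∑ k ∈ E, σ k ^ 2))
      ≤ (⨆ θ ∈ ellipsoid a, seqRisk σ θ f)
        + ENNReal.ofReal (10 / (α * δ) ^ 2
          * (Var[fun x => x ^ 2; gaussianReal 0 1] * (b / κ ^ 2))) := by
  classical
  have hb0 : 0 ≤ b := by
    by_contra hb0
    have : IsEmpty ι := ⟨fun k => hb0 ((sq_nonneg _).trans (hb k))⟩
    exact hκ.ne (by rw [← hroot, tsum_empty])
  set F := (hasFiniteSupport_pinskerWeight hlim hκ).toFinset \ E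
  have haF : ∀ k ∈ F, α ≤ a k := fun k hk => hE k (Finset.mem_sdiff.1 hk).2
  have hbayes : (1 - δ) * (∑' k, σ k ^ 2 * pinskerWeight a κ k - ∑ k ∈ E, σ k ^ 2)
      ≤ ∑ k ∈ F, σ k ^ 2 * pinskerPriorVar a σ δ κ k / (pinskerPriorVar a σ δ κ k + σ k ^ 2) := by
    calc _ ≤ (1 - δ) * ∑ k ∈ F, σ k ^ 2 * pinskerWeight a κ k :=
          mul_le_mul_of_nonneg_left (tsum_sub_sum_le_sum_sdiff
            (fun k hk => Function.notMem_support.1 (mt (Set.Finite.mem_toFinset _).2 hk))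
            (fun k => sq_nonneg _) fun k => pinskerWeight_le_one (mul_nonneg hκ.le (ha k)))
            (sub_nonneg.2 hδ1)
      _ ≤ _ := by
          rw [Finset.mul_sum]
          exact Finset.sum_le_sum fun k hk => le_bayesRisk_pinskerPriorVar hδ0.le hδ1
            (mul_pos hκ (hα.trans_le (haF k hk))) (hσ k)
  refine (ENNReal.ofReal_le_ofReal hbayes).trans ((ofReal_sum_bayesRisk_le_iSup_seqRisk_add hα haF
    hδ0 (fun k => pinskerPriorVar_nonneg hδ1 (mul_nonneg hκ.le (ha k)))
    (sum_sq_mul_pinskerPriorVar_le ha hlim hδ1 hκ hroot F) hσ hf).trans ?_)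
  gcongr
  · exact variance_nonneg _ _
  · exact sum_sq_sq_mul_pinskerPriorVar_le ha hlim hδ0.le hδ1 hb0 hb hκ hroot F

end PinskerPrior

section SobolevCoeff

/-- The even number `m` with `a_{β,i+1} = m ^ β`. -/
def sobolevIndex (i : ℕ) : ℕ := if Even (i + 1) then i + 1 else i

lemma sobolevCoeff_succ (β : ℝ) (i : ℕ) :
    sobolevCoeff β (i + 1) = (sobolevIndex i : ℝ) ^ β := by
  unfold sobolevCoeff sobolevIndex
  split_ifs <;> simp

lemma le_sobolevIndex (i : ℕ) : (i : ℝ) ≤ sobolevIndex i := by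
  unfold sobolevIndex
  split_ifs <;> simp

lemma sobolevIndex_le (i : ℕ) : (sobolevIndex i : ℝ) ≤ i + 1 := by
  unfold sobolevIndex
  split_ifs <;> simp

lemma rpow_le_sobolevCoeff {β : ℝ} (hβ : 0 ≤ β) (i : ℕ) :
    (i : ℝ) ^ β ≤ sobolevCoeff β (i + 1) := by
  rw [sobolevCoeff_succ]
  exact Real.rpow_le_rpow (Nat.cast_nonneg i) (le_sobolevIndex i) hβ

lemma tendsto_sobolevCoeff {β : ℝ} (hβ : 0 < β) :
    Tendsto (fun i => sobolevCoeff β (i + 1)) atTop atTop :=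
  tendsto_atTop_mono (rpow_le_sobolevCoeff hβ.le)
    ((tendsto_rpow_atTop hβ).comp tendsto_natCast_atTop_atTop)

end SobolevCoeff

section SpectralCoeff

variable {n : Type*} {β : ℝ} {q : n → ℝ}

/-- The ellipsoid coefficients `a_{β,i} / qⱼ` of the Sobolev ellipsoid in the coordinates
`√qⱼ (Uᵀ θᵢ)ⱼ`, where `Q = U diag(q) Uᵀ`. -/
def spectralCoeff (β : ℝ) (q : n → ℝ) (k : ℕ × n) : ℝ := sobolevCoeff β (k.1 + 1) / q k.2

/-- The noise levels `ε √qⱼ` of the observation in the coordinates `√qⱼ (Uᵀ yᵢ)ⱼ`, where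
`Q = U diag(q) Uᵀ`. -/
def spectralNoise (ε : ℝ) (q : n → ℝ) (k : ℕ × n) : ℝ := ε * √(q k.2)

lemma spectralCoeff_nonneg (hq : ∀ j, 0 < q j) (k : ℕ × n) : 0 ≤ spectralCoeff β q k := by
  have := hq k.2
  rw [spectralCoeff, sobolevCoeff_succ]
  positivity

lemma spectralNoise_ne_zero {ε : ℝ} (hε : ε ≠ 0) (hq : ∀ j, 0 < q j) (k : ℕ × n) :
    spectralNoise ε q k ≠ 0 :=
  mul_ne_zero hε (Real.sqrt_pos.2 (hq k.2)).ne'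

lemma spectralNoise_sq (ε : ℝ) (hq : ∀ j, 0 < q j) (k : ℕ × n) :
    spectralNoise ε q k ^ 2 = ε ^ 2 * q k.2 := by
  rw [spectralNoise, mul_pow, Real.sq_sqrt (hq k.2).le]

lemma tendsto_spectralCoeff [Finite n] (hβ : 0 < β) (hq : ∀ j, 0 < q j) :
    Tendsto (spectralCoeff β q) cofinite atTop := by
  cases nonempty_fintype n
  refine tendsto_atTop.2 fun c => eventually_cofinite.2 ?_
  have hfin : ∀ j, {i | sobolevCoeff β (i + 1) < c * q j}.Finite := fun j =>
    finite_setOf_lt_of_tendsto_cofinite (Nat.cofinite_eq_atTop ▸ tendsto_sobolevCoeff hβ) _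
  refine ((Set.finite_iUnion hfin).prod Set.finite_univ).subset fun k hk => ?_
  rw [Set.mem_ofPred_eq, not_le, spectralCoeff, div_lt_iff₀ (hq k.2)] at hk
  exact ⟨Set.mem_iUnion.2 ⟨k.2, hk⟩, Set.mem_univ _⟩

end SpectralCoeff

section Diagonalization

variable {p : ℕ} {β : ℝ} {Q U : Matrix (Fin p) (Fin p) ℝ} {q : Fin p → ℝ}

/-- `Q = U diag(q) Uᵀ` with `U` orthogonal and `q` positive, stated through the functional calculus
that it induces on `Q`. -/
structure IsDiagonalization (Q U : Matrix (Fin p) (Fin p) ℝ) (q : Fin p → ℝ) : Prop where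
  pos : ∀ j, 0 < q j
  mul_transpose : U * Uᵀ = 1
  transpose_mul : Uᵀ * U = 1
  isHermitian : Q.IsHermitian
  cfc_eq : ∀ f : ℝ → ℝ, cfc f Q = U * Matrix.diagonal (fun j => f (q j)) * Uᵀ

theorem exists_isDiagonalization (hQ : Q.PosDef) : ∃ U q, IsDiagonalization Q U q := by
  refine ⟨hQ.isHermitian.eigenvectorUnitary, hQ.isHermitian.eigenvalues,
    hQ.eigenvalues_pos, ?_, ?_, hQ.isHermitian, fun f => ?_⟩
  · exact Unitary.coe_mul_star_self hQ.isHermitian.eigenvectorUnitary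
  · exact Unitary.coe_star_mul_self hQ.isHermitian.eigenvectorUnitary
  · rw [hQ.isHermitian.cfc_eq, Matrix.IsHermitian.cfc, Unitary.conjStarAlgAut_apply]
    rfl

lemma quadForm_mul_diagonal_mul_transpose (U : Matrix (Fin p) (Fin p) ℝ) (d x : Fin p → ℝ) :
    quadForm (U * Matrix.diagonal d * Uᵀ) x = ∑ j, d j * (Uᵀ *ᵥ x) j ^ 2 := by
  unfold quadForm
  rw [← Matrix.mulVec_mulVec, ← Matrix.mulVec_mulVec, Matrix.dotProduct_mulVec,
    ← Matrix.mulVec_transpose]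
  simp only [dotProduct, Matrix.mulVec_diagonal]
  exact Finset.sum_congr rfl fun j _ => by ring

namespace IsDiagonalization

variable (h : IsDiagonalization Q U q)
include h

lemma quadForm_cfc (f : ℝ → ℝ) (x : Fin p → ℝ) :
    quadForm (cfc f Q) x = ∑ j, f (q j) * (Uᵀ *ᵥ x) j ^ 2 := by
  rw [h.cfc_eq, quadForm_mul_diagonal_mul_transpose]

lemma trace_cfc (f : ℝ → ℝ) : (cfc f Q).trace = ∑ j, f (q j) := by
  rw [h.cfc_eq, Matrix.trace_mul_comm, ← Matrix.mul_assoc, h.transpose_mul, Matrix.one_mul,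
    Matrix.trace_diagonal]

lemma inv_eq_cfc : Q⁻¹ = cfc (fun x : ℝ => x⁻¹) Q := by
  refine Matrix.inv_eq_right_inv ?_
  nth_rw 1 [← cfc_id ℝ Q h.isHermitian.isSelfAdjoint]
  have hcont : ∀ f : ℝ → ℝ, ContinuousOn f (spectrum ℝ Q) := Q.finite_real_spectrum.continuousOn
  rw [← cfc_mul _ _ _ (hcont _) (hcont _), h.cfc_eq]
  have : ∀ j, q j * (q j)⁻¹ = 1 := fun j => mul_inv_cancel₀ (h.pos j).ne'
  simp [this, h.mul_transpose]

lemma pinskerCoeff_eq_cfc (β κ : ℝ) (i : ℕ) :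
    pinskerCoeff β Q κ i = cfc (fun x : ℝ => max 0 (1 - sobolevCoeff β (i + 1) * κ * x⁻¹)) Q := by
  have hcont : ∀ f : ℝ → ℝ, ContinuousOn f (spectrum ℝ Q) := Q.finite_real_spectrum.continuousOn
  have hcont' : ∀ f g : ℝ → ℝ, ContinuousOn f (g '' spectrum ℝ Q) := fun f g =>
    (Q.finite_real_spectrum.image g).continuousOn f
  have hQ : IsSelfAdjoint Q := h.isHermitian.isSelfAdjoint
  rw [pinskerCoeff, matPosPart, h.inv_eq_cfc, ← cfc_smul _ _ _ (hcont _), ← cfc_const_one ℝ Q,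
    ← cfc_sub _ _ _ (hcont _) (hcont _), ← cfc_comp' _ _ _ (hcont' _ _) (hcont _)]
  rfl

end IsDiagonalization

end Diagonalization

section SpectralCoordinates

variable {p : ℕ} {β : ℝ} {Q U : Matrix (Fin p) (Fin p) ℝ} {q : Fin p → ℝ}

lemma measurable_sqLoss {ι : Type*} [Countable ι] (θ : ι → ℝ) : Measurable (sqLoss θ) :=
  Measurable.tsum fun k => by fun_prop

lemma pinskerWeight_spectralCoeff (κ : ℝ) (k : ℕ × Fin p) :
    pinskerWeight (spectralCoeff β q) κ k
      = max 0 (1 - sobolevCoeff β (k.1 + 1) * κ * (q k.2)⁻¹) := by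
  rw [pinskerWeight, spectralCoeff]
  ring_nf

lemma measurable_mulVec (A : Matrix (Fin p) (Fin p) ℝ) : Measurable fun x => A *ᵥ x :=
  (Matrix.mulVecLin A).continuous_of_finiteDimensional.measurable

namespace IsDiagonalization

variable (h : IsDiagonalization Q U q)
include h

lemma trace_pinskerCoeff (κ : ℝ) (i : ℕ) :
    (pinskerCoeff β Q κ i).trace = ∑ j, pinskerWeight (spectralCoeff β q) κ (i, j) := by
  simp only [h.pinskerCoeff_eq_cfc, h.trace_cfc, pinskerWeight_spectralCoeff]

lemma isPinskerRoot_iff (hβ : 0 < β) (ε κ : ℝ) :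
    IsPinskerRoot β Q ε κ
      ↔ 0 < κ ∧ ε ^ 2 * pinskerSum (spectralCoeff β q) (fun k => q k.2) κ⁻¹ = 1 := by
  refine and_congr_right fun hκ => ?_
  have hsum := summable_mul_pinskerWeight (tendsto_spectralCoeff hβ h.pos) hκ
    fun k => q k.2 * spectralCoeff β q k
  rw [pinskerSum_inv _ _ hκ, hsum.tsum_prod, mul_assoc]
  simp only [tsum_fintype, h.trace_pinskerCoeff, Finset.mul_sum, spectralCoeff,
    mul_div_cancel₀ _ (h.pos _).ne']

/-- The coordinates `√qⱼ (Uᵀ θᵢ)ⱼ` in which the loss becomes the squared `ℓ²` distance. -/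
def coordEquiv : Seq p ≃ᵐ (ℕ × Fin p → ℝ) where
  toFun θ k := √(q k.2) * (Uᵀ *ᵥ θ k.1) k.2
  invFun x i := U *ᵥ fun j => x (i, j) / √(q j)
  left_inv θ := by
    ext1 i
    have : ∀ j, √(q j) ≠ 0 := fun j => (Real.sqrt_pos.2 (h.pos j)).ne'
    simp [this, Matrix.mulVec_mulVec, h.mul_transpose]
  right_inv x := by
    ext1 k
    have : √(q k.2) ≠ 0 := (Real.sqrt_pos.2 (h.pos k.2)).ne'
    simp only [Matrix.mulVec_mulVec, h.transpose_mul, Matrix.one_mulVec]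
    field_simp
  measurable_toFun := by
    refine measurable_pi_iff.2 fun k => Measurable.const_mul ?_ _
    exact measurable_pi_iff.1 ((measurable_mulVec Uᵀ).comp (measurable_pi_apply k.1)) k.2
  measurable_invFun := by
    refine measurable_pi_iff.2 fun i => (measurable_mulVec U).comp ?_
    fun_prop

lemma loss_eq (θ t : Seq p) : loss Q θ t = sqLoss (h.coordEquiv θ) (h.coordEquiv t) := by
  rw [loss, sqLoss, ENNReal.tsum_prod']
  refine tsum_congr fun i => ?_
  rw [tsum_fintype, ← ENNReal.ofReal_sum_of_nonneg fun j _ => sq_nonneg _]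
  nth_rw 1 [← cfc_id ℝ Q h.isHermitian.isSelfAdjoint]
  rw [h.quadForm_cfc, Matrix.mulVec_sub]
  congr! 2 with j
  change q j * ((Uᵀ *ᵥ t i) j - (Uᵀ *ᵥ θ i) j) ^ 2
    = (√(q j) * (Uᵀ *ᵥ t i) j - √(q j) * (Uᵀ *ᵥ θ i) j) ^ 2
  rw [← mul_sub, mul_pow, Real.sq_sqrt (h.pos j).le]

lemma mem_sobolevEllipsoid_iff (θ : Seq p) :
    θ ∈ sobolevEllipsoid β Q ↔ h.coordEquiv θ ∈ ellipsoid (spectralCoeff β q) := by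
  change (_ : ℝ≥0∞) ≤ 1 ↔ (_ : ℝ≥0∞) ≤ 1
  rw [ENNReal.tsum_prod']
  congr! 4 with i
  rw [tsum_fintype, ← ENNReal.ofReal_sum_of_nonneg fun j _ => by positivity, h.inv_eq_cfc,
    h.quadForm_cfc, Finset.mul_sum]
  congr! 2 with j
  change _ = spectralCoeff β q (i, j) ^ 2 * (√(q j) * (Uᵀ *ᵥ θ i) j) ^ 2
  rw [mul_pow, Real.sq_sqrt (h.pos j).le, spectralCoeff]
  field [(h.pos j).ne']

lemma measurePreserving_mulVec_noiseLaw :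
    MeasurePreserving (fun ξ i => U *ᵥ fun j => ξ (i, j)) (stdGaussianPi (ℕ × Fin p))
      (noiseLaw p) := by
  have hblocks := measurePreserving_infinitePi (ι := ℕ) (μ := fun _ => stdGaussianPi (Fin p))
    fun _ => measurePreserving_mulVec_stdGaussianPi
      ((Matrix.mem_orthogonalGroup_iff _ _).2 h.mul_transpose)
  have hnoise : noiseLaw p = Measure.infinitePi fun _ : ℕ => stdGaussianPi (Fin p) := by
    simp only [noiseLaw, stdGaussianPi_eq_pi]
  rw [hnoise]
  exact hblocks.comp measurePreserving_curry_stdGaussianPi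

lemma map_observation (ε : ℝ) (θ : Seq p) :
    (observationLaw ε θ).map h.coordEquiv
      = (stdGaussianPi (ℕ × Fin p)).map fun ξ => h.coordEquiv θ + spectralNoise ε q * ξ := by
  have hshift : Measurable fun (ξ : Seq p) i => θ i + ε • ξ i := by fun_prop
  have hnoise := h.measurePreserving_mulVec_noiseLaw
  rw [observationLaw, ← hnoise.map_eq, Measure.map_map hshift hnoise.measurable,
    Measure.map_map h.coordEquiv.measurable (hshift.comp hnoise.measurable)]
  congr 1
  ext ξ k
  change √(q k.2) * (Uᵀ *ᵥ (θ k.1 + ε • U *ᵥ fun j => ξ (k.1, j))) k.2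
    = √(q k.2) * (Uᵀ *ᵥ θ k.1) k.2 + ε * √(q k.2) * ξ k
  rw [Matrix.mulVec_add, Matrix.mulVec_smul, Matrix.mulVec_mulVec, h.transpose_mul,
    Matrix.one_mulVec, Pi.add_apply, Pi.smul_apply, smul_eq_mul]
  ring

lemma risk_eq (ε : ℝ) (θ : Seq p) (f : Estimator p) :
    risk Q ε θ f = seqRisk (spectralNoise ε q) (h.coordEquiv θ)
      (h.coordEquiv ∘ f.1 ∘ h.coordEquiv.symm) := by
  have hloss : Measurable fun y => sqLoss (h.coordEquiv θ)
      ((h.coordEquiv ∘ f.1 ∘ h.coordEquiv.symm) y) :=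
    (measurable_sqLoss _).comp (h.coordEquiv.measurable.comp
      (f.2.comp h.coordEquiv.symm.measurable))
  rw [seqRisk, ← lintegral_map hloss (by fun_prop), ← h.map_observation, lintegral_map_equiv, risk]
  simp only [h.loss_eq, Function.comp_apply, MeasurableEquiv.symm_apply_apply]

lemma maxRisk_eq (ε : ℝ) (f : Estimator p) :
    maxRisk Q ε (sobolevEllipsoid β Q) f = ⨆ x ∈ ellipsoid (spectralCoeff β q),
      seqRisk (spectralNoise ε q) x (h.coordEquiv ∘ f.1 ∘ h.coordEquiv.symm) := by
  refine h.coordEquiv.toEquiv.iSup_congr fun θ => ?_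
  rw [h.risk_eq]
  exact iSup_congr_Prop (h.mem_sobolevEllipsoid_iff θ).symm fun _ => rfl

lemma coordEquiv_comp_linearEstimator (κ : ℝ) :
    h.coordEquiv ∘ (linearEstimator (pinskerCoeff β Q κ)).1 ∘ h.coordEquiv.symm
      = fun y => pinskerWeight (spectralCoeff β q) κ * y := by
  ext y k
  set w : Fin p → ℝ := fun j => pinskerWeight (spectralCoeff β q) κ (k.1, j)
  have hcoeff : pinskerCoeff β Q κ k.1 = U * Matrix.diagonal w * Uᵀ := by
    simp only [h.pinskerCoeff_eq_cfc, h.cfc_eq, w, pinskerWeight_spectralCoeff]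
  have hconj : Uᵀ * (U * Matrix.diagonal w * Uᵀ) * U = Matrix.diagonal w := by
    simp only [← Matrix.mul_assoc, h.transpose_mul, Matrix.one_mul]
    rw [Matrix.mul_assoc, h.transpose_mul, Matrix.mul_one]
  change √(q k.2) * (Uᵀ *ᵥ (pinskerCoeff β Q κ k.1 *ᵥ (U *ᵥ fun j => y (k.1, j) / √(q j)))) k.2
    = w k.2 * y k
  rw [hcoeff, Matrix.mulVec_mulVec, Matrix.mulVec_mulVec, hconj, Matrix.mulVec_diagonal]
  have : √(q k.2) ≠ 0 := (Real.sqrt_pos.2 (h.pos k.2)).ne'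
  field_simp

end IsDiagonalization

end SpectralCoordinates

section PinskerValue

variable {p : ℕ} {β : ℝ} {Q U : Matrix (Fin p) (Fin p) ℝ} {q : Fin p → ℝ}

/-- The leading term `ε² ∑ₖ qⱼ (1 - κ aₖ)₊` of the minimax risk at the root `κ`, where `k = (i, j)`
and `aₖ` are the spectral coefficients. -/
def pinskerValue (β : ℝ) (q : Fin p → ℝ) (ε κ : ℝ) : ℝ :=
  ε ^ 2 * ∑' k : ℕ × Fin p, q k.2 * pinskerWeight (spectralCoeff β q) κ k

lemma tsum_spectralNoise_sq_mul_pinskerWeight (hq : ∀ j, 0 < q j) (ε κ : ℝ) :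
    ∑' k, spectralNoise ε q k ^ 2 * pinskerWeight (spectralCoeff β q) κ k
      = pinskerValue β q ε κ := by
  simp only [pinskerValue, spectralNoise_sq ε hq, mul_assoc, tsum_mul_left]

namespace IsDiagonalization

variable (h : IsDiagonalization Q U q)
include h

theorem existsUnique_isPinskerRoot (hp : 0 < p) (hβ : 0 < β) {ε : ℝ} (hε : ε ≠ 0) :
    ∃! κ, IsPinskerRoot β Q ε κ := by
  have hpos : ∃ k : ℕ × Fin p, 0 < q k.2 * spectralCoeff β q k := by
    refine ⟨(1, ⟨0, hp⟩), mul_pos (h.pos _) (div_pos ?_ (h.pos _))⟩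
    exact one_pos.trans_le (by simpa using rpow_le_sobolevCoeff hβ.le 1)
  have hinv : Function.Bijective fun κ : ℝ => κ⁻¹ := inv_involutive.bijective
  have hunique := (hinv.existsUnique_iff).1 <| existsUnique_pinskerSum_eq
    (spectralCoeff_nonneg (β := β) h.pos) (tendsto_spectralCoeff hβ h.pos)
    (fun k => (h.pos k.2).le) hpos (c := (ε ^ 2)⁻¹) (by positivity)
  refine (existsUnique_congr fun κ => ?_).1 hunique
  rw [h.isPinskerRoot_iff hβ, inv_pos, mul_comm (ε ^ 2), mul_eq_one_iff_eq_inv₀ (pow_ne_zero 2 hε)]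

lemma sq_mul_tsum_spectralCoeff_mul_pinskerWeight (hβ : 0 < β) {ε κ : ℝ}
    (hκ : IsPinskerRoot β Q ε κ) :
    ε ^ 2 * ∑' k : ℕ × Fin p, q k.2 * spectralCoeff β q k * pinskerWeight (spectralCoeff β q) κ k
      = κ := by
  have hκ0 : 0 < κ := hκ.1
  have := ((h.isPinskerRoot_iff hβ ε κ).1 hκ).2
  rw [pinskerSum_inv _ _ hκ0] at this
  field_simp at this
  exact this

lemma tsum_spectralNoise_sq_mul_spectralCoeff (hβ : 0 < β) {ε κ : ℝ}
    (hκ : IsPinskerRoot β Q ε κ) :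
    ∑' k, spectralNoise ε q k ^ 2 * spectralCoeff β q k * pinskerWeight (spectralCoeff β q) κ k
      = κ := by
  simpa only [spectralNoise_sq ε h.pos, mul_assoc, tsum_mul_left]
    using h.sq_mul_tsum_spectralCoeff_mul_pinskerWeight hβ hκ

theorem maxRisk_linearEstimator_le (hβ : 0 < β) {ε κ : ℝ} (hκ : IsPinskerRoot β Q ε κ) :
    maxRisk Q ε (sobolevEllipsoid β Q) (linearEstimator (pinskerCoeff β Q κ))
      ≤ ENNReal.ofReal (pinskerValue β q ε κ) := by
  rw [h.maxRisk_eq, h.coordEquiv_comp_linearEstimator, ← tsum_spectralNoise_sq_mul_pinskerWeight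
    h.pos]
  exact iSup₂_le fun θ hθ => seqRisk_pinskerWeight_le (spectralCoeff_nonneg h.pos)
    (tendsto_spectralCoeff hβ h.pos) hκ.1 (h.tsum_spectralNoise_sq_mul_spectralCoeff hβ hκ) hθ

theorem ofReal_le_minimaxRisk (hβ : 0 < β) {ε κ : ℝ} (hε : ε ≠ 0) (hκ : IsPinskerRoot β Q ε κ)
    {E : Finset (ℕ × Fin p)} {α : ℝ} (hα : 0 < α) (hE : ∀ k ∉ E, α ≤ spectralCoeff β q k)
    {δ : ℝ} (hδ0 : 0 < δ) (hδ1 : δ ≤ 1) :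
    ENNReal.ofReal ((1 - δ) * (pinskerValue β q ε κ - ε ^ 2 * ∑ k ∈ E, q k.2)
        - 10 / (α * δ) ^ 2 *
          (Var[fun x => x ^ 2; gaussianReal 0 1] * (ε ^ 2 * (∑ j, q j) / κ ^ 2)))
      ≤ minimaxRisk Q ε (sobolevEllipsoid β Q) := by
  have hq0 : ∀ j ∈ Finset.univ, 0 ≤ q j := fun j _ => (h.pos j).le
  have hnoise : ∀ k, spectralNoise ε q k ^ 2 ≤ ε ^ 2 * ∑ j, q j := fun k => by
    rw [spectralNoise_sq ε h.pos]
    exact mul_le_mul_of_nonneg_left (Finset.single_le_sum hq0 (Finset.mem_univ k.2)) (sq_nonneg ε)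
  refine le_iInf fun f => ?_
  have hlower := ofReal_le_iSup_seqRisk_add (spectralCoeff_nonneg (β := β) h.pos)
    (tendsto_spectralCoeff hβ h.pos) hα hE hδ0 hδ1 (spectralNoise_ne_zero hε h.pos)
    hnoise hκ.1 (h.tsum_spectralNoise_sq_mul_spectralCoeff hβ hκ)
    (h.coordEquiv.measurable.comp (f.2.comp h.coordEquiv.symm.measurable))
  rw [← h.maxRisk_eq, tsum_spectralNoise_sq_mul_pinskerWeight h.pos] at hlower
  simp only [spectralNoise_sq ε h.pos, ← Finset.mul_sum] at hlower
  have hvar := variance_nonneg (fun x => x ^ 2) (gaussianReal 0 1)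
  have hsum := Finset.sum_nonneg hq0
  rw [ENNReal.ofReal_sub _ (by positivity)]
  exact tsub_le_iff_right.2 hlower

end IsDiagonalization

end PinskerValue

section Asymptotics

variable {n : Type*} {β : ℝ} {q : n → ℝ}

lemma integral_max_one_sub_rpow (hβ : 0 < β) :
    ∫ x in (0 : ℝ)..1, max 0 (1 - x ^ β) = β / (β + 1) := by
  have hpos : ∀ x ∈ Set.uIcc (0 : ℝ) 1, max 0 (1 - x ^ β) = 1 - x ^ β := fun x hx => by
    rw [Set.uIcc_of_le zero_le_one] at hx
    exact max_eq_right (sub_nonneg.2 (Real.rpow_le_one hx.1 hx.2 hβ.le))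
  rw [intervalIntegral.integral_congr hpos, intervalIntegral.integral_sub intervalIntegrable_const
    (intervalIntegral.intervalIntegrable_rpow' (by linarith)), integral_rpow (Or.inl (by linarith)),
    intervalIntegral.integral_const, Real.zero_rpow (by linarith), Real.one_rpow]
  simp only [smul_eq_mul]
  field

lemma integral_rpow_mul_max_one_sub_rpow (hβ : 0 < β) :
    ∫ x in (0 : ℝ)..1, x ^ β * max 0 (1 - x ^ β) = β / (β + 1) / (2 * β + 1) := by
  have hpos : ∀ x ∈ Set.uIcc (0 : ℝ) 1, x ^ β * max 0 (1 - x ^ β) = x ^ β - x ^ (2 * β) := by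
    intro x hx
    rw [Set.uIcc_of_le zero_le_one] at hx
    rw [max_eq_right (sub_nonneg.2 (Real.rpow_le_one hx.1 hx.2 hβ.le)), mul_comm 2 β,
      Real.rpow_mul hx.1, Real.rpow_two]
    ring
  rw [intervalIntegral.integral_congr hpos, intervalIntegral.integral_sub
    (intervalIntegral.intervalIntegrable_rpow' (by linarith))
    (intervalIntegral.intervalIntegrable_rpow' (by linarith)), integral_rpow (Or.inl (by linarith)),
    integral_rpow (Or.inl (by linarith)), Real.zero_rpow (by linarith),
    Real.zero_rpow (by linarith), Real.one_rpow, Real.one_rpow]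
  field

lemma tendsto_rpow_nhdsGT_zero {r : ℝ} (hr : 0 < r) :
    Tendsto (fun x : ℝ => x ^ r) (𝓝[>] 0) (𝓝[>] 0) := by
  refine tendsto_nhdsWithin_iff.2 ⟨?_, ?_⟩
  · simpa [Real.zero_rpow hr.ne'] using
      ((Real.continuous_rpow_const hr.le).tendsto 0).mono_left nhdsWithin_le_nhds
  · filter_upwards [self_mem_nhdsWithin] with x hx using Real.rpow_pos_of_pos hx r

lemma tendsto_div_nhdsGT_zero {c : ℝ} (hc : 0 < c) :
    Tendsto (fun x : ℝ => x / c) (𝓝[>] 0) (𝓝[>] 0) := by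
  refine tendsto_nhdsWithin_iff.2 ⟨?_, ?_⟩
  · simpa using ((continuous_id.div_const c).tendsto 0).mono_left nhdsWithin_le_nhds
  · filter_upwards [self_mem_nhdsWithin] with x hx using div_pos hx hc

variable {φ : ℝ → ℝ}

lemma tsum_spectralCoeff_eq_sum_tsum [Fintype n] (hβ : 0 < β) (hq : ∀ j, 0 < q j)
    (hφ1 : ∀ y, 1 ≤ y → φ y = 0) {κ : ℝ} (hκ : 0 < κ) :
    ∑' k : ℕ × n, q k.2 * φ (κ * spectralCoeff β q k)
      = ∑ j, q j * ∑' i : ℕ, φ (((κ / q j) ^ (1 / β) * sobolevIndex i) ^ β) := by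
  have hsum : Summable fun k : ℕ × n => q k.2 * φ (κ * spectralCoeff β q k) := by
    have hfin := finite_setOf_lt_of_tendsto_cofinite (tendsto_spectralCoeff hβ hq) κ⁻¹
    refine summable_of_hasFiniteSupport <| hfin.subset fun k hk =>
      not_le.1 fun hle : κ⁻¹ ≤ _ => hk ?_
    exact mul_eq_zero_of_right _ (hφ1 _ ((inv_le_iff_one_le_mul₀' hκ).1 hle))
  have hrow : ∀ i j, κ * spectralCoeff β q (i, j)
      = ((κ / q j) ^ (1 / β) * sobolevIndex i) ^ β := fun i j => by
    have := (div_pos hκ (hq j)).le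
    rw [spectralCoeff, sobolevCoeff_succ, Real.mul_rpow (by positivity) (by positivity),
      ← Real.rpow_mul this, one_div_mul_cancel hβ.ne', Real.rpow_one]
    ring
  calc ∑' k : ℕ × n, q k.2 * φ (κ * spectralCoeff β q k)
      = ∑' k : n × ℕ, q k.1 * φ (κ * spectralCoeff β q (k.2, k.1)) :=
        ((Equiv.prodComm n ℕ).tsum_eq _).symm
    _ = ∑' j, ∑' i, q j * φ (κ * spectralCoeff β q (i, j)) := hsum.prod_symm.tsum_prod
    _ = _ := by simp only [tsum_fintype, tsum_mul_left, hrow]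

theorem tendsto_rpow_mul_tsum_spectralCoeff [Fintype n] (hβ : 0 < β) (hq : ∀ j, 0 < q j)
    (hφ : Continuous φ) (hφ1 : ∀ y, 1 ≤ y → φ y = 0) :
    Tendsto (fun κ : ℝ => κ ^ (1 / β) * ∑' k : ℕ × n, q k.2 * φ (κ * spectralCoeff β q k)) (𝓝[>] 0)
      (𝓝 ((∑ j, q j ^ ((β + 1) / β)) * ∫ x in (0 : ℝ)..1, φ (x ^ β))) := by
  have hriemann := tendsto_mul_tsum_tagged (hφ.comp (Real.continuous_rpow_const hβ.le))
    (fun x hx => hφ1 _ (Real.one_le_rpow hx hβ.le)) le_sobolevIndex sobolevIndex_le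
  have hrow : ∀ j, Tendsto (fun κ : ℝ => (κ / q j) ^ (1 / β)) (𝓝[>] 0) (𝓝[>] 0) := fun j =>
    (tendsto_rpow_nhdsGT_zero (by positivity)).comp (tendsto_div_nhdsGT_zero (hq j))
  have hrows := tendsto_finsetSum Finset.univ fun j _ =>
    (hriemann.comp (hrow j)).const_mul (q j ^ ((β + 1) / β))
  rw [← Finset.sum_mul] at hrows
  refine hrows.congr' ?_
  filter_upwards [self_mem_nhdsWithin] with κ hκ
  rw [tsum_spectralCoeff_eq_sum_tsum hβ hq hφ1 hκ, Finset.mul_sum]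
  refine Finset.sum_congr rfl fun j _ => ?_
  have hpow : q j ^ ((β + 1) / β) = q j * q j ^ (1 / β) := by
    rw [add_div, div_self hβ.ne', Real.rpow_one_add' (hq j).le (by positivity)]
  have := (Real.rpow_pos_of_pos (hq j) (1 / β)).ne'
  simp only [Function.comp_apply, hpow, Real.div_rpow (le_of_lt hκ) (hq j).le]
  field

end Asymptotics

section Rates

variable {p : ℕ} {β : ℝ} {Q U : Matrix (Fin p) (Fin p) ℝ} {q : Fin p → ℝ} {κ : ℝ → ℝ}

/-- The constant `B = β tr(Q^{(β+1)/β}) / (β+1)` such that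
`κ^{1/β} ∑ₖ qⱼ (1 - κ aₖ)₊ → B` as `κ → 0`, where `k = (i, j)` and `aₖ` are the spectral
coefficients. -/
def pinskerDim (β : ℝ) (Q : Matrix (Fin p) (Fin p) ℝ) : ℝ :=
  β * (matRpow Q ((β + 1) / β)).trace / (β + 1)

lemma pinskerConst_mul_rpow (hβ : 0 < β) (hB : 0 < pinskerDim β Q) :
    pinskerConst β Q * (pinskerDim β Q / (2 * β + 1)) ^ (1 / (2 * β + 1)) = pinskerDim β Q := by
  have hd : 0 < 2 * β + 1 := by positivity
  have hexp : pinskerDim β Q ^ (2 * β / (2 * β + 1)) * pinskerDim β Q ^ (1 / (2 * β + 1))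
      = pinskerDim β Q := by
    rw [← Real.rpow_add hB, ← add_div, div_self hd.ne', Real.rpow_one]
  have hne := (Real.rpow_pos_of_pos hd (1 / (2 * β + 1))).ne'
  change (2 * β + 1) ^ (1 / (2 * β + 1)) * pinskerDim β Q ^ (2 * β / (2 * β + 1)) * _ = _
  rw [Real.div_rpow hB.le hd.le]
  field_simp
  exact hexp

lemma pinskerConst_pos (hβ : 0 < β) (hB : 0 < pinskerDim β Q) : 0 < pinskerConst β Q :=
  mul_pos (Real.rpow_pos_of_pos (by positivity) _) (Real.rpow_pos_of_pos hB _)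

lemma rpow_mul_rpow_div_sq {ε κ : ℝ} (hβ : 0 < β) (hε : 0 < ε) (hκ : 0 < κ) :
    (κ ^ (1 / β) * (κ ^ 2 / ε ^ 2)) ^ (1 / (2 * β + 1)) * ε ^ 2
      = κ ^ (1 / β) * ε ^ (4 * β / (2 * β + 1)) := by
  have hκpow : κ ^ (1 / β * (1 / (2 * β + 1))) * κ ^ (2 * (1 / (2 * β + 1))) = κ ^ (1 / β) := by
    rw [← Real.rpow_add hκ]
    congr 1
    field
  have hεpow : ε ^ (4 * β / (2 * β + 1)) * ε ^ (2 * (1 / (2 * β + 1))) = ε ^ (2 : ℝ) := by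
    rw [← Real.rpow_add hε]
    congr 1
    field
  have hne := (Real.rpow_pos_of_pos hε (2 * (1 / (2 * β + 1)))).ne'
  rw [← Real.rpow_two, ← Real.rpow_two, Real.mul_rpow (by positivity) (by positivity),
    Real.div_rpow (by positivity) (by positivity), ← Real.rpow_mul hκ.le, ← Real.rpow_mul hκ.le,
    ← Real.rpow_mul hε.le, ← mul_div_assoc, hκpow, ← hεpow]
  field

namespace IsDiagonalization

variable (h : IsDiagonalization Q U q)
include h

lemma pinskerDim_eq (β : ℝ) :
    pinskerDim β Q = (∑ j, q j ^ ((β + 1) / β)) * (β / (β + 1)) := by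
  rw [pinskerDim, matRpow, h.trace_cfc]
  ring

lemma pinskerDim_pos (hp : 0 < p) (hβ : 0 < β) : 0 < pinskerDim β Q := by
  have : Nonempty (Fin p) := ⟨⟨0, hp⟩⟩
  have hsum := Finset.sum_pos (fun j _ => Real.rpow_pos_of_pos (h.pos j) ((β + 1) / β))
    Finset.univ_nonempty
  rw [h.pinskerDim_eq]
  positivity

theorem tendsto_rpow_mul_tsum_pinskerWeight (hβ : 0 < β) :
    Tendsto (fun κ : ℝ => κ ^ (1 / β) *
      ∑' k : ℕ × Fin p, q k.2 * pinskerWeight (spectralCoeff β q) κ k) (𝓝[>] 0)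
      (𝓝 (pinskerDim β Q)) := by
  have hlim := tendsto_rpow_mul_tsum_spectralCoeff hβ h.pos (φ := fun y => max 0 (1 - y))
    (by fun_prop) fun y hy => max_eq_left (sub_nonpos.2 hy)
  rwa [integral_max_one_sub_rpow hβ, ← h.pinskerDim_eq] at hlim

theorem tendsto_rpow_mul_tsum_mul_pinskerWeight (hβ : 0 < β) :
    Tendsto (fun κ : ℝ => κ ^ (1 / β) * ∑' k : ℕ × Fin p,
      q k.2 * (κ * spectralCoeff β q k * pinskerWeight (spectralCoeff β q) κ k)) (𝓝[>] 0)
      (𝓝 (pinskerDim β Q / (2 * β + 1))) := by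
  have hlim := tendsto_rpow_mul_tsum_spectralCoeff hβ h.pos (φ := fun y => y * max 0 (1 - y))
    (by fun_prop) fun y hy => mul_eq_zero_of_right y (max_eq_left (sub_nonpos.2 hy))
  rwa [integral_rpow_mul_max_one_sub_rpow hβ, ← mul_div_assoc, ← h.pinskerDim_eq] at hlim

lemma tendsto_pinskerRoot (hβ : 0 < β) (hκ : ∀ ε, 0 < ε → IsPinskerRoot β Q ε (κ ε)) :
    Tendsto κ (𝓝[>] 0) (𝓝[>] 0) := by
  have hκ0 : ∀ᶠ ε in 𝓝[>] 0, 0 < κ ε := by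
    filter_upwards [self_mem_nhdsWithin] with ε hε using (hκ ε hε).1
  refine tendsto_nhdsWithin_iff.2 ⟨tendsto_order.2
    ⟨fun c hc => hκ0.mono fun ε hε => hc.trans hε, fun c hc => ?_⟩, hκ0⟩
  have hsmall : ∀ᶠ ε : ℝ in 𝓝[>] 0,
      ε ^ 2 * pinskerSum (spectralCoeff β q) (fun k => q k.2) c⁻¹ < 1 := by
    have hcont : Continuous fun ε : ℝ =>
      ε ^ 2 * pinskerSum (spectralCoeff β q) (fun k => q k.2) c⁻¹ := by fun_prop
    exact (hcont.continuousWithinAt (s := Set.Ioi 0) (x := 0)).eventually_lt_const (by simp)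
  filter_upwards [self_mem_nhdsWithin, hsmall] with ε hε hlt
  have hroot := ((h.isPinskerRoot_iff hβ ε _).1 (hκ ε hε)).2
  have hmono := monotone_pinskerSum (spectralCoeff_nonneg h.pos) (tendsto_spectralCoeff hβ h.pos)
    fun k : ℕ × Fin p => (h.pos k.2).le
  refine not_le.1 fun hle => (hroot.symm.trans_le ?_).not_gt hlt
  exact mul_le_mul_of_nonneg_left (hmono (inv_anti₀ hc hle)) (sq_nonneg ε)

theorem tendsto_pinskerValue_div (hp : 0 < p) (hβ : 0 < β)
    (hκ : ∀ ε, 0 < ε → IsPinskerRoot β Q ε (κ ε)) :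
    Tendsto (fun ε => pinskerValue β q ε (κ ε) / (pinskerConst β Q * ε ^ (4 * β / (2 * β + 1))))
      (𝓝[>] 0) (𝓝 1) := by
  have hB := h.pinskerDim_pos hp hβ
  have hP := pinskerConst_pos hβ hB
  have hroot := h.tendsto_pinskerRoot hβ hκ
  have hnum := (h.tendsto_rpow_mul_tsum_pinskerWeight hβ).comp hroot
  have hden := ((((h.tendsto_rpow_mul_tsum_mul_pinskerWeight hβ).comp hroot).rpow_const
    (p := 1 / (2 * β + 1)) (Or.inl (by positivity))).const_mul (pinskerConst β Q))
  rw [pinskerConst_mul_rpow hβ hB] at hden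
  have hratio := hnum.div hden hB.ne'
  rw [div_self hB.ne'] at hratio
  refine hratio.congr' ?_
  filter_upwards [self_mem_nhdsWithin] with ε hε
  have hκ0 : 0 < κ ε := (hκ ε hε).1
  have hε0 : 0 < ε := hε
  have hmass : ∑' k : ℕ × Fin p,
      q k.2 * (κ ε * spectralCoeff β q k * pinskerWeight (spectralCoeff β q) (κ ε) k)
        = κ ε ^ 2 / ε ^ 2 := by
    have := h.sq_mul_tsum_spectralCoeff_mul_pinskerWeight hβ (hκ ε hε)
    simp only [mul_left_comm (q _) (κ ε), mul_assoc (κ ε), tsum_mul_left, ← mul_assoc (q _)]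
    rw [eq_div_iff (by positivity)]
    linear_combination κ ε * this
  have hrate := rpow_mul_rpow_div_sq hβ hε0 hκ0
  simp only [Pi.div_apply, Function.comp_apply, hmass]
  rw [pinskerValue, div_eq_div_iff (by positivity) (by positivity)]
  linear_combination (-pinskerConst β Q *
    ∑' k : ℕ × Fin p, q k.2 * pinskerWeight (spectralCoeff β q) (κ ε) k) * hrate

lemma eventually_pinskerRate_pos (hp : 0 < p) (hβ : 0 < β) :
    ∀ᶠ ε : ℝ in 𝓝[>] 0, 0 < pinskerConst β Q * ε ^ (4 * β / (2 * β + 1)) := by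
  filter_upwards [self_mem_nhdsWithin] with ε hε using
    mul_pos (pinskerConst_pos hβ (h.pinskerDim_pos hp hβ)) (Real.rpow_pos_of_pos hε _)

lemma eventually_pinskerValue_pos (hp : 0 < p) (hβ : 0 < β)
    (hκ : ∀ ε, 0 < ε → IsPinskerRoot β Q ε (κ ε)) :
    ∀ᶠ ε in 𝓝[>] 0, 0 < pinskerValue β q ε (κ ε) := by
  filter_upwards [h.eventually_pinskerRate_pos hp hβ,
    (h.tendsto_pinskerValue_div hp hβ hκ).eventually_const_lt one_pos] with ε hrate hratio
  exact (div_pos_iff_of_pos_right hrate).1 hratio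

lemma rpow_div_le_spectralCoeff (hβ : 0 < β) {δ κ : ℝ} (hδ : 0 ≤ δ) (hκ : 0 < κ)
    {k : ℕ × Fin p} (hk : δ * κ ^ (-(1 / β)) ≤ k.1) :
    δ ^ β / (∑ j, q j) / κ ≤ spectralCoeff β q k := by
  have hpow : (δ * κ ^ (-(1 / β))) ^ β = δ ^ β / κ := by
    rw [Real.mul_rpow hδ (by positivity), ← Real.rpow_mul hκ.le, neg_mul,
      one_div_mul_cancel hβ.ne', Real.rpow_neg_one, div_eq_mul_inv]
  have hnum : (δ * κ ^ (-(1 / β))) ^ β ≤ sobolevCoeff β (k.1 + 1) :=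
    (Real.rpow_le_rpow (by positivity) hk hβ.le).trans (rpow_le_sobolevCoeff hβ.le k.1)
  rw [div_right_comm, ← hpow]
  exact div_le_div₀ (le_trans (by positivity) hnum) hnum (h.pos k.2)
    (Finset.single_le_sum (fun j _ => (h.pos j).le) (Finset.mem_univ k.2))

theorem exists_ofReal_le_minimaxRisk (hp : 0 < p) (hβ : 0 < β) {δ : ℝ} (hδ0 : 0 < δ)
    (hδ1 : δ ≤ 1) :
    ∃ C, ∀ {ε κ : ℝ}, ε ≠ 0 → IsPinskerRoot β Q ε κ →
      ENNReal.ofReal ((1 - δ) *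
          (pinskerValue β q ε κ - ε ^ 2 * ((δ * κ ^ (-(1 / β)) + 1) * ∑ j, q j)) - ε ^ 2 * C)
        ≤ minimaxRisk Q ε (sobolevEllipsoid β Q) := by
  have : Nonempty (Fin p) := ⟨⟨0, hp⟩⟩
  set s := ∑ j, q j
  have hs : 0 < s := Finset.sum_pos (fun j _ => h.pos j) Finset.univ_nonempty
  refine ⟨10 / (δ ^ β / s * δ) ^ 2 * (Var[fun x => x ^ 2; gaussianReal 0 1] * s),
    fun {ε κ} hε hκ => ?_⟩
  have hκ0 : 0 < κ := hκ.1
  set n := ⌈δ * κ ^ (-(1 / β))⌉₊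
  have hcoeff : ∀ k ∉ Finset.range n ×ˢ (Finset.univ : Finset (Fin p)),
      δ ^ β / s / κ ≤ spectralCoeff β q k := fun k hk => by
    have hnk : n ≤ k.1 := by simpa using hk
    exact h.rpow_div_le_spectralCoeff hβ hδ0.le hκ0 (Nat.ceil_le.1 hnk)
  refine le_trans (ENNReal.ofReal_le_ofReal ?_)
    (h.ofReal_le_minimaxRisk hβ hε hκ (by positivity) hcoeff hδ0 hδ1)
  have hn : (n : ℝ) ≤ δ * κ ^ (-(1 / β)) + 1 := (Nat.ceil_lt_add_one (by positivity)).le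
  have hsum : ∑ k ∈ Finset.range n ×ˢ (Finset.univ : Finset (Fin p)), q k.2 = n * s := by
    simp [Finset.sum_product, s]
  have hC : 10 / (δ ^ β / s / κ * δ) ^ 2 *
      (Var[fun x => x ^ 2; gaussianReal 0 1] * (ε ^ 2 * s / κ ^ 2))
        = ε ^ 2 * (10 / (δ ^ β / s * δ) ^ 2 * (Var[fun x => x ^ 2; gaussianReal 0 1] * s)) := by
    field
  rw [hsum, hC]
  gcongr

theorem eventually_ofReal_mul_pinskerValue_le_minimaxRisk (hp : 0 < p) (hβ : 0 < β)
    (hκ : ∀ ε, 0 < ε → IsPinskerRoot β Q ε (κ ε)) {c : ℝ} (hc : c < 1) :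
    ∀ᶠ ε in 𝓝[>] 0, ENNReal.ofReal (c * pinskerValue β q ε (κ ε))
      ≤ minimaxRisk Q ε (sobolevEllipsoid β Q) := by
  set B := pinskerDim β Q
  have hB : 0 < B := h.pinskerDim_pos hp hβ
  set s := ∑ j, q j
  obtain ⟨δ, hδB, hδ0, hδ1⟩ : ∃ δ, c * B < (1 - δ) * (B - δ * s) ∧ 0 < δ ∧ δ ≤ 1 := by
    have hcont : Continuous fun δ => (1 - δ) * (B - δ * s) := by fun_prop
    have hev := (hcont.continuousWithinAt (s := Set.Ioi 0) (x := 0)).eventually_const_lt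
      (u := c * B) (by nlinarith)
    exact (hev.and (Ioc_mem_nhdsGT one_pos)).exists
  obtain ⟨C, hC⟩ := h.exists_ofReal_le_minimaxRisk hp hβ hδ0 hδ1
  have hdim := h.tendsto_rpow_mul_tsum_pinskerWeight hβ
  have hpow := (tendsto_rpow_nhdsGT_zero (one_div_pos.2 hβ)).mono_right nhdsWithin_le_nhds
  have hlower := (((hdim.sub ((hpow.const_add δ).mul_const s)).const_mul (1 - δ)).sub
    (hpow.mul_const C))
  rw [add_zero, zero_mul, sub_zero] at hlower
  filter_upwards [self_mem_nhdsWithin, (h.tendsto_pinskerRoot hβ hκ).eventually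
    ((hdim.const_mul c).eventually_lt hlower hδB)] with ε hε hlt
  have hε0 : 0 < ε := hε
  have hκ0 : 0 < κ ε := (hκ ε hε).1
  refine (ENNReal.ofReal_le_ofReal ?_).trans (hC hε0.ne' (hκ ε hε))
  have hscaled := mul_le_mul_of_nonneg_left hlt.le (a := ε ^ 2 * κ ε ^ (-(1 / β))) (by positivity)
  have hinv : κ ε ^ (-(1 / β)) * κ ε ^ (1 / β) = 1 := by
    rw [← Real.rpow_add hκ0, neg_add_cancel, Real.rpow_zero]
  set S := ∑' k : ℕ × Fin p, q k.2 * pinskerWeight (spectralCoeff β q) (κ ε) k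
  change c * (ε ^ 2 * S) ≤ (1 - δ) * (ε ^ 2 * S - _) - _
  linear_combination hscaled - ε ^ 2 * (c * S - (1 - δ) * (S - s) + C) * hinv

end IsDiagonalization

end Rates

end MPinsker

end

open MPinsker in
theorem mainTheorem2 (p : ℕ) (hp : 0 < p) (β : ℝ) (hβ : 0 < β)
    (Q : Matrix (Fin p) (Fin p) ℝ) (hQ : Q.PosDef) :
    (∀ ε : ℝ, 0 < ε → ∃! κ : ℝ, MPinsker.IsPinskerRoot β Q ε κ) ∧
    ∀ κ : ℝ → ℝ, (∀ ε : ℝ, 0 < ε → MPinsker.IsPinskerRoot β Q ε (κ ε)) →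
      MPinsker.AsympEquiv
        (fun ε => MPinsker.maxRisk Q ε (MPinsker.sobolevEllipsoid β Q)
          (MPinsker.linearEstimator (MPinsker.pinskerCoeff β Q (κ ε))))
        (fun ε => MPinsker.minimaxRisk Q ε (MPinsker.sobolevEllipsoid β Q)) ∧
      MPinsker.AsympEquiv
        (fun ε => MPinsker.maxRisk Q ε (MPinsker.sobolevEllipsoid β Q)
          (MPinsker.linearEstimator (MPinsker.pinskerCoeff β Q (κ ε))))
        (fun ε => ENNReal.ofReal
          (MPinsker.pinskerConst β Q * ε ^ (4 * β / (2 * β + 1)))) ∧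
      MPinsker.AsympEquiv
        (fun ε => MPinsker.minimaxRisk Q ε (MPinsker.sobolevEllipsoid β Q))
        (fun ε => ENNReal.ofReal
          (MPinsker.pinskerConst β Q * ε ^ (4 * β / (2 * β + 1)))) := by
  obtain ⟨U, q, h⟩ := exists_isDiagonalization hQ
  refine ⟨fun ε hε => h.existsUnique_isPinskerRoot hp hβ hε.ne', fun κ hκ => ?_⟩
  have hminimax_le : ∀ ε, minimaxRisk Q ε (sobolevEllipsoid β Q) ≤
      maxRisk Q ε (sobolevEllipsoid β Q) (linearEstimator (pinskerCoeff β Q (κ ε))) :=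
    fun ε => iInf_le _ _
  have hmax_le : ∀ᶠ ε in 𝓝[>] 0, maxRisk Q ε (sobolevEllipsoid β Q)
      (linearEstimator (pinskerCoeff β Q (κ ε))) ≤ ENNReal.ofReal (pinskerValue β q ε (κ ε)) := by
    filter_upwards [self_mem_nhdsWithin] with ε hε using h.maxRisk_linearEstimator_le hβ (hκ ε hε)
  have hle_minimax := fun c (hc : c < 1) =>
    h.eventually_ofReal_mul_pinskerValue_le_minimaxRisk hp hβ hκ hc
  have hpos := h.eventually_pinskerValue_pos hp hβ hκ
  have hmax := asympEquiv_ofReal_of_forall_mul_le hpos hmax_le fun c hc =>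
    (hle_minimax c hc).mono fun ε hε => hε.trans (hminimax_le ε)
  have hminimax := asympEquiv_ofReal_of_forall_mul_le hpos
    (hmax_le.mono fun ε => (hminimax_le ε).trans) hle_minimax
  have hvalue := asympEquiv_ofReal (h.eventually_pinskerRate_pos hp hβ)
    (h.tendsto_pinskerValue_div hp hβ hκ)
  exact ⟨hmax.trans hminimax.symm, hmax.trans hvalue, hminimax.trans hvalue⟩
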